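/- Let $\Omega\subset\mathbb C$ be a bounded domain whose boundary $\Gamma=\partial\Omega$ is an analytic Jordan curve (without cusps), i.e. the image of the unit circle under a map that is holomorphic and injective in a neighbourhood of the circle; give $\Gamma$ the positive orientation. Let $0<\sigma<1$ and let $\Lambda_\sigma(\Gamma)$ be the space of complex-valued Hölder continuous functions of order $\sigma$ on $\Gamma$. For $F\in\Lambda_\sigma(\Gamma)$ let $\Pi F$ be the function on $\Gamma$ given by the boundary values, from inside $\Omega$, of the double layer potential $$u(z)=\frac1\pi\int_\Gamma F(\zeta)\,\frac{\partial}{\partial N_\zeta}\log|z-\zeta|\,ds_\zeta ,\qquad z\in\Omega,$$ where $N_\zeta$ is the outward unit normal to $\Gamma$ at $\zeta$ and $ds$ is arclength. If the complex linear space $\{F\in\Lambda_\sigma(\Gamma):\Pi F=F\}$ of fixed points of $\Pi$ contains a non-constant function, then it is infinite-dimensional over $\mathbb C$. -/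

import Mathlib

open Set Filter Topology
open scoped NNReal ComplexConjugate

noncomputable section

/-- A bounded planar domain `Ω` whose boundary is an analytic Jordan curve `Γ` (without cusps),
together with a positively oriented parametrization of `Γ`. The curve is the image of the unit
circle under a map that is holomorphic and injective in a neighbourhood of the circle; the
parametrization is `θ ↦ param (exp (i θ))`. -/
structure AnalyticJordanDomain where
  /-- the domain `Ω` -/
  carrier : Set ℂ
  /-- the map `Φ` with `Γ = Φ (unit circle)` -/
  param : ℂ → ℂ
  univalent : ∃ U : Set ℂ, IsOpen U ∧ Metric.sphere (0 : ℂ) 1 ⊆ U ∧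
    DifferentiableOn ℂ param U ∧ InjOn param U
  isOpen : IsOpen carrier
  isConnected : IsConnected carrier
  isBounded : Bornology.IsBounded carrier
  frontier_eq : frontier carrier = param '' Metric.sphere (0 : ℂ) 1
  /-- positive orientation: `Γ` winds once counterclockwise around each point of `Ω` -/
  winding_eq_one : ∀ z ∈ carrier,
    (2 * Real.pi * Complex.I)⁻¹ * (∮ w in C(0, 1), deriv param w / (param w - z)) = 1

namespace AnalyticJordanDomain

variable (D : AnalyticJordanDomain)

/-- The boundary curve `Γ`. -/
def curve : Set ℂ := D.param '' Metric.sphere (0 : ℂ) 1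

/-- The point of `Γ` with parameter `θ`. -/
def point (θ : ℝ) : D.curve :=
  ⟨D.param (circleMap 0 1 θ), circleMap 0 1 θ, circleMap_mem_sphere 0 zero_le_one θ, rfl⟩

/-- The velocity `d/dθ Φ(exp (i θ)) = i exp (i θ) Φ'(exp (i θ))` of the parametrization. -/
def velocity (θ : ℝ) : ℂ := Complex.I * circleMap 0 1 θ * deriv D.param (circleMap 0 1 θ)

/-- The outward unit normal to `Γ`: the unit tangent turned clockwise by a right angle. -/
def normal (θ : ℝ) : ℂ := -Complex.I * (D.velocity θ / (‖D.velocity θ‖ : ℂ))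

/-- The normal derivative of the logarithmic kernel `ζ ↦ log |z - ζ|` at a point of `Γ`. -/
def kernel (z : ℂ) (θ : ℝ) : ℝ :=
  lineDeriv ℝ (fun ζ : ℂ => Real.log ‖z - ζ‖) (D.point θ : ℂ) (D.normal θ)

/-- The double layer potential `u(z) = π⁻¹ ∫_Γ F(ζ) ∂/∂N_ζ (log |z - ζ|) ds_ζ` of the dipole
density `F`, with `ds = ‖velocity‖ dθ` the arclength. -/
def doubleLayer (F : D.curve → ℂ) (z : ℂ) : ℂ :=
  (Real.pi : ℂ)⁻¹ * ∫ θ in (0 : ℝ)..(2 * Real.pi),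
    F (D.point θ) * (D.kernel z θ : ℂ) * (‖D.velocity θ‖ : ℂ)

/-- The space `Λ_σ(Γ)` of complex-valued Hölder continuous functions of order `σ` on `Γ`. -/
def holderSpace (σ : ℝ≥0) : Submodule ℂ (D.curve → ℂ) where
  carrier := {F | ∃ C : ℝ≥0, HolderWith C σ F}
  zero_mem' := ⟨0, by
    intro x y
    simp⟩
  add_mem' := by
    rintro F G ⟨C, hF⟩ ⟨C', hG⟩
    exact ⟨C + C', hF.add hG⟩
  smul_mem' := by
    rintro c F ⟨C, hF⟩
    exact ⟨C * ‖c‖₊, hF.smul c⟩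

/-- `D.IsPi F G` says that `Π F = G`: the double layer potential with density `F` has at every
point of `Γ` the boundary value from `Ω` prescribed by `G`. -/
def IsPi (F G : D.curve → ℂ) : Prop :=
  ∀ ζ : D.curve, Tendsto (D.doubleLayer F) (𝓝[D.carrier] (ζ : ℂ)) (𝓝 (G ζ))

theorem point_mem_frontier (θ : ℝ) : (D.point θ : ℂ) ∈ frontier D.carrier := by
  rw [D.frontier_eq]
  exact (D.point θ).2

theorem point_ne {z : ℂ} (hz : z ∈ D.carrier) (θ : ℝ) : (D.point θ : ℂ) - z ≠ 0 := by
  intro h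
  have h1 := D.point_mem_frontier θ
  rw [sub_eq_zero.mp h, D.isOpen.frontier_eq] at h1
  exact h1.2 hz

theorem kernel_eq {z : ℂ} (hz : z ∈ D.carrier) (θ : ℝ) :
    D.kernel z θ = (D.normal θ / ((D.point θ : ℂ) - z)).re := by
  have hne := D.point_ne hz θ
  have hne' : z - (D.point θ : ℂ) ≠ 0 := by
    rw [← neg_sub]
    exact neg_ne_zero.mpr hne
  unfold kernel lineDeriv
  have h0 : HasDerivAt (fun t : ℝ => z - ((D.point θ : ℂ) + t • D.normal θ))
      (-D.normal θ) 0 := by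
    have := (((hasDerivAt_id (0 : ℝ)).smul_const (D.normal θ)).const_add
      (D.point θ : ℂ)).const_sub z
    simpa using this
  have h1 := h0.norm_sq
  have h2 := (h1.log (by simpa using hne')).const_mul (1 / 2 : ℝ)
  have h3 : (fun t : ℝ => Real.log ‖z - ((D.point θ : ℂ) + t • D.normal θ)‖) =
      fun t : ℝ => (1 / 2 : ℝ) * Real.log (‖z - ((D.point θ : ℂ) + t • D.normal θ)‖ ^ 2) := by
    funext t
    rw [Real.log_pow]
    push_cast
    ring
  rw [h3, h2.deriv]
  simp only [zero_smul, add_zero, Complex.inner, Complex.div_re, ← Complex.normSq_eq_norm_sq]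
  have h4 : Complex.normSq (z - (D.point θ : ℂ)) = Complex.normSq ((D.point θ : ℂ) - z) := by
    rw [← neg_sub, Complex.normSq_neg]
  have h5 : Complex.normSq ((D.point θ : ℂ) - z) ≠ 0 := by simpa using hne
  rw [h4]
  field_simp
  simp
  ring

theorem continuous_velocity : Continuous D.velocity := by
  obtain ⟨U, hU, hS, hd, -⟩ := D.univalent
  have h1 : ContinuousOn (deriv D.param) U := (hd.deriv hU).continuousOn
  have h2 : Continuous fun θ : ℝ => deriv D.param (circleMap 0 1 θ) :=
    h1.comp_continuous (continuous_circleMap 0 1)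
      fun θ => hS (circleMap_mem_sphere 0 zero_le_one θ)
  exact (continuous_const.mul (continuous_circleMap 0 1)).mul h2

theorem continuous_point : Continuous D.point := by
  obtain ⟨U, hU, hS, hd, -⟩ := D.univalent
  exact Continuous.subtype_mk (hd.continuousOn.comp_continuous (continuous_circleMap 0 1)
    fun θ => hS (circleMap_mem_sphere 0 zero_le_one θ)) _

/-- The integrand of the double layer potential in terms of the parametrization. -/
theorem kernel_mul_speed {z : ℂ} (hz : z ∈ D.carrier) (θ : ℝ) :
    D.kernel z θ * ‖D.velocity θ‖ = (D.velocity θ / ((D.point θ : ℂ) - z)).im := by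
  rw [D.kernel_eq hz]
  by_cases hv : D.velocity θ = 0
  · simp [hv]
  have hv' : (‖D.velocity θ‖ : ℂ) ≠ 0 := by simpa using hv
  rw [← Complex.re_mul_ofReal]
  have : D.normal θ / ((D.point θ : ℂ) - z) * (‖D.velocity θ‖ : ℂ) =
      -Complex.I * (D.velocity θ / ((D.point θ : ℂ) - z)) := by
    unfold normal
    field_simp
  rw [this]
  simp

theorem continuous_integrand {F : D.curve → ℂ} (hF : Continuous F) {z : ℂ}
    (hz : z ∈ D.carrier) :
    Continuous fun θ => F (D.point θ) * (D.kernel z θ : ℂ) * (‖D.velocity θ‖ : ℂ) := by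
  have h1 : (fun θ => F (D.point θ) * (D.kernel z θ : ℂ) * (‖D.velocity θ‖ : ℂ)) =
      fun θ => F (D.point θ) * (((D.velocity θ / ((D.point θ : ℂ) - z)).im : ℝ) : ℂ) := by
    funext θ
    rw [← D.kernel_mul_speed hz θ]
    push_cast
    ring
  rw [h1]
  refine (hF.comp D.continuous_point).mul (Complex.continuous_ofReal.comp
    (Complex.continuous_im.comp (D.continuous_velocity.div ?_ (D.point_ne hz))))
  exact (continuous_subtype_val.comp D.continuous_point).sub continuous_const

theorem doubleLayer_add {F G : D.curve → ℂ} (hF : Continuous F) (hG : Continuous G) {z : ℂ}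
    (hz : z ∈ D.carrier) :
    D.doubleLayer (F + G) z = D.doubleLayer F z + D.doubleLayer G z := by
  unfold doubleLayer
  rw [← mul_add, ← intervalIntegral.integral_add
    ((D.continuous_integrand hF hz).intervalIntegrable _ _)
    ((D.continuous_integrand hG hz).intervalIntegrable _ _)]
  simp only [Pi.add_apply, add_mul]

theorem doubleLayer_smul (c : ℂ) (F : D.curve → ℂ) (z : ℂ) :
    D.doubleLayer (c • F) z = c * D.doubleLayer F z := by
  unfold doubleLayer
  simp only [Pi.smul_apply, smul_eq_mul, mul_assoc, intervalIntegral.integral_const_mul]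
  ring

/-- The space of fixed points of `Π` in `Λ_σ(Γ)`, for `σ > 0`. -/
def fixedPoints (σ : ℝ≥0) (hσ : 0 < σ) : Submodule ℂ (D.curve → ℂ) where
  carrier := {F | F ∈ D.holderSpace σ ∧ D.IsPi F F}
  zero_mem' := by
    refine ⟨Submodule.zero_mem _, fun ζ => ?_⟩
    have h : D.doubleLayer (0 : D.curve → ℂ) = fun _ => 0 := by
      funext z
      simp [doubleLayer]
    rw [h]
    exact tendsto_const_nhds
  add_mem' := by
    rintro F G ⟨hF, hF'⟩ ⟨hG, hG'⟩
    refine ⟨Submodule.add_mem _ hF hG, fun ζ => ?_⟩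
    obtain ⟨C, hC⟩ := hF
    obtain ⟨C', hC'⟩ := hG
    refine ((hF' ζ).add (hG' ζ)).congr' ?_
    filter_upwards [self_mem_nhdsWithin] with z hz
    exact (D.doubleLayer_add (hC.continuous hσ) (hC'.continuous hσ) hz).symm
  smul_mem' := by
    rintro c F ⟨hF, hF'⟩
    refine ⟨Submodule.smul_mem _ c hF, fun ζ => ?_⟩
    refine ((hF' ζ).const_mul c).congr fun z => ?_
    exact (D.doubleLayer_smul c F z).symm

end AnalyticJordanDomain

end

/-!
The argument rests on a matching problem. Write `C q` for the Cauchy integral over the boundary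
curve `Γ` of a Hölder continuous density `q`, and let `a` and `-b` be its boundary values from inside
and from outside (`innerValue`, and `outerValue = -b`). By the Sokhotski–Plemelj formula
(`tendsto_cauchy`) the jump `a + b` is `q`. The double layer potential of `q` is
`C q + conj (C (conj q))` (`doubleLayer_eq`), so `q` is a fixed point of `Π` exactly when the inner
boundary values of `C q` are conjugate to minus the outer boundary values of `C (conj q)`: the
conjugate of the boundary function `a` of the holomorphic function `f = C q` is itself the boundary
function of a function holomorphic outside and vanishing at infinity.

This relation is multiplicative. The powers `a ^ n`, `n ≥ 1`, are again boundary values from inside,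
of `f ^ n`, and the powers `conj a ^ n` are boundary values from outside. Hence
`2 Re a ^ n = a ^ n + conj a ^ n` has the Cauchy integral `f ^ n`, and is again a fixed point
(`not_finiteDimensional_fixedPoints`). If `f` is not constant, its powers are linearly independent,
since a nonconstant continuous function on a connected set has infinitely many values. If both `C q`
and `C (conj q)` are constant, so is `q`.

Three facts carry this out. The boundary values must again be Hölder continuous of the same order,
which is Privalov's theorem (`ChordArcLoop.exists_isHolder_sing`). The powers must be reproduced or
annihilated by the Cauchy integral (`cauchy_innerValue_pow`, `cauchy_outerValue_pow`): the integral
over `Γ` is moved to a parallel curve in a collar, where Fubini's theorem and partial fractions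
(`integral_cauchyType_mul_cauchyType`) allow induction on the exponent without any Cauchy theorem
in the exterior domain. Finally, that one half of the collar lies in `Ω` and that the curve does not
wind around the other half (`nonempty_collar`) replaces the Jordan curve theorem: otherwise a bounded
nonempty subset of the plane would be open and closed.
-/

/-! ### Chord-arc loops and the singular Cauchy integral -/

noncomputable section

/-- A closed `2π`-periodic plane curve `p` with Lipschitz velocity `v` that satisfies the
chord-arc condition `c |s - t| ≤ ‖p s - p t‖`. The condition is asked for up to parameter distance
`3π/2` (three quarters of a period), so that it still covers a full period centred at a point at
distance at most `π/2`. -/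
structure ChordArcLoop where
  /-- the curve -/
  p : ℝ → ℂ
  /-- its velocity -/
  v : ℝ → ℂ
  /-- Lipschitz constant of the velocity -/
  L : ℝ
  /-- bound for the speed -/
  V : ℝ
  /-- chord-arc constant -/
  c : ℝ
  c_pos : 0 < c
  hasDerivAt : ∀ t, HasDerivAt p (v t) t
  periodic_p : Function.Periodic p (2 * Real.pi)
  periodic_v : Function.Periodic v (2 * Real.pi)
  lipschitz : ∀ s t, ‖v s - v t‖ ≤ L * |s - t|
  speed_le : ∀ t, ‖v t‖ ≤ V
  chord : ∀ s t, |s - t| ≤ 3 * Real.pi / 2 → c * |s - t| ≤ ‖p s - p t‖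

theorem intervalIntegrable_abs_rpow {r : ℝ} (hr : -1 < r) (a b : ℝ) :
    IntervalIntegrable (fun t : ℝ => |t| ^ r) MeasureTheory.volume a b := by
  refine intervalIntegrable_of_even (fun x => by simp) (fun x hx => ?_)
  refine (intervalIntegral.intervalIntegrable_rpow' (a := 0) (b := x) hr).congr ?_
  intro t ht
  rw [uIoc_of_le hx.le] at ht
  simp [abs_of_pos ht.1]

theorem intervalIntegrable_abs_sub_rpow {r : ℝ} (hr : -1 < r) (x a b : ℝ) :
    IntervalIntegrable (fun t : ℝ => |t - x| ^ r) MeasureTheory.volume a b := by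
  simpa using (intervalIntegrable_abs_rpow hr (a - x) (b - x)).comp_sub_right x

theorem integral_abs_rpow {r : ℝ} (hr : -1 < r) {d : ℝ} (hd : 0 ≤ d) :
    ∫ t in (-d)..d, |t| ^ r = 2 * (d ^ (r + 1) / (r + 1)) := by
  have h1 : ∫ t in (0 : ℝ)..d, |t| ^ r = d ^ (r + 1) / (r + 1) := by
    have : ∫ t in (0 : ℝ)..d, |t| ^ r = ∫ t in (0 : ℝ)..d, t ^ r := by
      refine intervalIntegral.integral_congr fun t ht => ?_
      rw [uIcc_of_le hd] at ht
      simp [abs_of_nonneg ht.1]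
    rw [this, integral_rpow (Or.inl hr), Real.zero_rpow (by linarith), sub_zero]
  have h2 : ∫ t in (-d)..0, |t| ^ r = ∫ t in (0 : ℝ)..d, |t| ^ r := by
    have := intervalIntegral.integral_comp_neg (a := 0) (b := d) (fun t : ℝ => |t| ^ r)
    simp only [abs_neg, neg_zero] at this
    exact this.symm
  rw [← intervalIntegral.integral_add_adjacent_intervals (intervalIntegrable_abs_rpow hr _ 0)
    (intervalIntegrable_abs_rpow hr 0 _), h2, h1]
  ring

theorem integral_abs_sub_rpow_le {r : ℝ} (hr : -1 < r) {x δ : ℝ} (hδ : 0 ≤ δ) (hx : |x| ≤ δ) :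
    ∫ t in (0 : ℝ)..(2 * δ), |t - x| ^ r ≤ 2 * ((3 * δ) ^ (r + 1) / (r + 1)) := by
  rw [← integral_abs_rpow hr (by positivity : 0 ≤ 3 * δ),
    intervalIntegral.integral_comp_sub_right (fun t : ℝ => |t| ^ r) x]
  have := abs_le.mp hx
  refine intervalIntegral.integral_mono_interval (by linarith) (by linarith) (by linarith)
    (Eventually.of_forall fun t => by positivity) (intervalIntegrable_abs_rpow hr _ _)

namespace ChordArcLoop

variable (γ : ChordArcLoop)

theorem continuous_p : Continuous γ.p :=
  continuous_iff_continuousAt.mpr fun t => (γ.hasDerivAt t).continuousAt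

theorem L_nonneg : 0 ≤ γ.L := by
  have := (norm_nonneg _).trans (γ.lipschitz 1 0)
  simpa using this

theorem V_nonneg : 0 ≤ γ.V := (norm_nonneg _).trans (γ.speed_le 0)

theorem continuous_v : Continuous γ.v := by
  have : LipschitzWith γ.L.toNNReal γ.v := by
    refine LipschitzWith.of_dist_le_mul fun s t => ?_
    rw [dist_eq_norm, Real.dist_eq, Real.coe_toNNReal _ γ.L_nonneg]
    exact γ.lipschitz s t
  exact this.continuous

theorem norm_p_sub_le (s t : ℝ) : ‖γ.p s - γ.p t‖ ≤ γ.V * |s - t| :=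
  Convex.norm_image_sub_le_of_norm_hasDerivWithin_le (s := univ)
    (fun x _ => (γ.hasDerivAt x).hasDerivWithinAt) (fun x _ => γ.speed_le x) convex_univ
    (mem_univ _) (mem_univ _)

/-- The kernel `dζ/(ζ - η)` of the Cauchy integral at parameters `s` of `ζ` and `t` of `η`. -/
def cauchyKernel (s t : ℝ) : ℂ := γ.v s / (γ.p s - γ.p t)

theorem p_sub_ne_zero {s t : ℝ} (h : s ≠ t) (hst : |s - t| ≤ 3 * Real.pi / 2) :
    γ.p s - γ.p t ≠ 0 := by
  have h1 := γ.chord s t hst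
  have h2 : 0 < γ.c * |s - t| := mul_pos γ.c_pos (abs_pos.mpr (sub_ne_zero.mpr h))
  exact norm_pos_iff.mp (h2.trans_le h1)

theorem norm_cauchyKernel_le {s t : ℝ} (hst : |s - t| ≤ 3 * Real.pi / 2) :
    ‖γ.cauchyKernel s t‖ ≤ γ.V / γ.c * |s - t|⁻¹ := by
  rcases eq_or_ne s t with rfl | h
  · simp [cauchyKernel]
  have h2 : 0 < |s - t| := abs_pos.mpr (sub_ne_zero.mpr h)
  have hc := γ.c_pos
  rw [cauchyKernel, norm_div]
  calc ‖γ.v s‖ / ‖γ.p s - γ.p t‖ ≤ γ.V / (γ.c * |s - t|) :=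
        div_le_div₀ γ.V_nonneg (γ.speed_le s) (by positivity) (γ.chord s t hst)
    _ = _ := by field_simp

/-- The Cauchy kernel differs from `1/(s - t)` by a bounded function; this is what makes
its principal values bounded. -/
theorem norm_cauchyKernel_sub_inv_le {s t : ℝ} (h : s ≠ t) (hst : |s - t| ≤ 3 * Real.pi / 2) :
    ‖γ.cauchyKernel s t - ((s - t : ℝ) : ℂ)⁻¹‖ ≤ γ.L / γ.c := by
  have h2 : 0 < |s - t| := abs_pos.mpr (sub_ne_zero.mpr h)
  have h3 := γ.p_sub_ne_zero h hst
  have h4 : ((s - t : ℝ) : ℂ) ≠ 0 := by exact_mod_cast sub_ne_zero.mpr h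
  have hc := γ.c_pos
  have key : ‖(γ.p t - t * γ.v s) - (γ.p s - s * γ.v s)‖ ≤ (γ.L * |s - t|) * ‖t - s‖ := by
    refine Convex.norm_image_sub_le_of_norm_hasDerivWithin_le (𝕜 := ℝ) (s := uIcc s t)
      (f := fun x : ℝ => γ.p x - x * γ.v s) (f' := fun x => γ.v x - γ.v s)
      (fun x _ => ?_) (fun x hx => ?_) (convex_uIcc s t) left_mem_uIcc right_mem_uIcc
    · have := (γ.hasDerivAt x).sub ((Complex.ofRealCLM.hasDerivAt (x := x)).mul_const (γ.v s))
      simp only [Complex.ofRealCLM_apply, Complex.ofReal_one, one_mul] at this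
      exact this.hasDerivWithinAt
    · refine (γ.lipschitz x s).trans (mul_le_mul_of_nonneg_left ?_ γ.L_nonneg)
      rw [abs_sub_comm s t]
      exact abs_sub_left_of_mem_uIcc hx
  have e : γ.cauchyKernel s t - ((s - t : ℝ) : ℂ)⁻¹ =
      ((γ.p t - t * γ.v s) - (γ.p s - s * γ.v s)) / ((γ.p s - γ.p t) * ((s - t : ℝ) : ℂ)) := by
    rw [cauchyKernel]
    field_simp
    push_cast
    ring
  rw [e, norm_div, norm_mul, Complex.norm_real, Real.norm_eq_abs,
    div_le_div_iff₀ (by positivity) hc]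
  have h5 := γ.chord s t hst
  rw [Real.norm_eq_abs, abs_sub_comm t s] at key
  calc _ ≤ γ.L * |s - t| * |s - t| * γ.c := by gcongr
    _ = γ.L * ((γ.c * |s - t|) * |s - t|) := by ring
    _ ≤ _ := by
      gcongr
      exact γ.L_nonneg

/-- A `2π`-periodic Hölder continuous density of order `σ`. -/
structure IsHolder (q : ℝ → ℂ) (C σ : ℝ) : Prop where
  periodic : Function.Periodic q (2 * Real.pi)
  bound : ∀ s t, ‖q s - q t‖ ≤ C * |s - t| ^ σ

theorem IsHolder.nonneg {q : ℝ → ℂ} {C σ : ℝ} (h : IsHolder q C σ) : 0 ≤ C := by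
  have := (norm_nonneg _).trans (h.bound 1 0)
  simpa using this

theorem IsHolder.continuous {q : ℝ → ℂ} {C σ : ℝ} (h : IsHolder q C σ) (hσ : 0 < σ) :
    Continuous q := by
  refine continuous_iff_continuousAt.mpr fun t => ?_
  have h1 : Tendsto (fun s : ℝ => C * |s - t| ^ σ) (𝓝 t) (𝓝 0) := by
    have : ContinuousAt (fun s : ℝ => C * |s - t| ^ σ) t :=
      continuousAt_const.mul ((by fun_prop : ContinuousAt (fun s : ℝ => |s - t|) t).rpow_const
        (Or.inr hσ.le))
    simpa [ContinuousAt, Real.zero_rpow hσ.ne'] using this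
  exact tendsto_iff_norm_sub_tendsto_zero.mpr
    (squeeze_zero (fun _ => norm_nonneg _) (fun s => h.bound s t) h1)

theorem IsHolder.const_mul {q : ℝ → ℂ} {C σ : ℝ} (hq : IsHolder q C σ) (c : ℂ) :
    IsHolder (fun s => c * q s) (‖c‖ * C) σ := by
  refine ⟨fun s => by simp only [hq.periodic s], fun s t => ?_⟩
  rw [← mul_sub, norm_mul, mul_assoc]
  gcongr
  exact hq.bound s t

theorem IsHolder.add {q r : ℝ → ℂ} {C C' σ : ℝ} (hq : IsHolder q C σ)
    (hr : IsHolder r C' σ) :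
    IsHolder (fun s => q s + r s) (C + C') σ := by
  refine ⟨fun s => by simp only [hq.periodic s, hr.periodic s], fun s t => ?_⟩
  rw [add_sub_add_comm, add_mul]
  exact (norm_add_le _ _).trans (add_le_add (hq.bound s t) (hr.bound s t))

/-- The desingularized integrand of the Cauchy integral on the curve. -/
def singIntegrand (q : ℝ → ℂ) (t s : ℝ) : ℂ := (q s - q t) * γ.cauchyKernel s t

/-- The desingularized Cauchy integral `∫ (q(ζ) - q(η)) dζ / (ζ - η)` on the curve. -/
def sing (q : ℝ → ℂ) (t : ℝ) : ℂ := ∫ s in (-Real.pi)..Real.pi, γ.singIntegrand q t (t + s)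

variable {γ} {q : ℝ → ℂ} {C σ : ℝ}

theorem norm_singIntegrand_le (hq : IsHolder q C σ) {s t : ℝ}
    (hst : |s - t| ≤ 3 * Real.pi / 2) :
    ‖γ.singIntegrand q t s‖ ≤ C * (γ.V / γ.c) * |s - t| ^ (σ - 1) := by
  rcases eq_or_ne s t with rfl | h
  · have := hq.nonneg
    have := γ.V_nonneg
    have := γ.c_pos
    simp only [singIntegrand, sub_self, zero_mul, norm_zero]
    positivity
  have h2 : 0 < |s - t| := abs_pos.mpr (sub_ne_zero.mpr h)
  have := hq.nonneg
  rw [singIntegrand, norm_mul]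
  calc _ ≤ (C * |s - t| ^ σ) * (γ.V / γ.c * |s - t|⁻¹) := by
        gcongr
        · exact hq.bound s t
        · exact γ.norm_cauchyKernel_le hst
    _ = _ := by
      rw [Real.rpow_sub h2, Real.rpow_one]
      ring

theorem measurable_singIntegrand (hq : IsHolder q C σ) (hσ : 0 < σ) (t : ℝ) :
    Measurable (γ.singIntegrand q t) := by
  unfold singIntegrand cauchyKernel
  exact ((hq.continuous hσ).measurable.sub_const _).mul
    (γ.continuous_v.measurable.div (γ.continuous_p.measurable.sub_const _))

theorem intervalIntegrable_singIntegrand (hq : IsHolder q C σ) (hσ : 0 < σ) {t a b : ℝ}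
    (ha : |a - t| ≤ 3 * Real.pi / 2) (hb : |b - t| ≤ 3 * Real.pi / 2) :
    IntervalIntegrable (γ.singIntegrand q t) MeasureTheory.volume a b := by
  refine ((intervalIntegrable_abs_sub_rpow (by linarith : -1 < σ - 1) t a b).const_mul
    (C * (γ.V / γ.c))).mono_fun (measurable_singIntegrand hq hσ t).aestronglyMeasurable ?_
  filter_upwards [MeasureTheory.ae_restrict_mem measurableSet_uIoc] with s hs
  have hs' : |s - t| ≤ 3 * Real.pi / 2 := by
    have := uIoc_subset_uIcc hs
    rw [abs_le] at *
    rcases mem_uIcc.mp this with h | h <;> constructor <;> linarith [h.1, h.2]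
  exact (norm_singIntegrand_le hq hs').trans (le_abs_self _)

theorem periodic_singIntegrand (hq : IsHolder q C σ) (t : ℝ) :
    Function.Periodic (γ.singIntegrand q t) (2 * Real.pi) := by
  intro s
  simp only [singIntegrand, cauchyKernel, hq.periodic s, γ.periodic_p s, γ.periodic_v s]

theorem sing_eq (hq : IsHolder q C σ) (t u : ℝ) :
    γ.sing q t = ∫ s in (-Real.pi)..Real.pi, γ.singIntegrand q t (u + s) := by
  rw [sing, intervalIntegral.integral_comp_add_left, intervalIntegral.integral_comp_add_left]
  have := (periodic_singIntegrand (γ := γ) hq t).intervalIntegral_add_eq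
    (t + -Real.pi) (u + -Real.pi)
  convert this using 2 <;> ring

theorem periodic_sing (hq : IsHolder q C σ) : Function.Periodic (γ.sing q) (2 * Real.pi) := by
  intro t
  rw [sing_eq hq (t + 2 * Real.pi) t, sing]
  simp only [singIntegrand, cauchyKernel, hq.periodic t, γ.periodic_p t]

theorem norm_sing_le (hq : IsHolder q C σ) (hσ : 0 < σ) (t : ℝ) :
    ‖γ.sing q t‖ ≤ C * (γ.V / γ.c) * (2 * (Real.pi ^ σ / σ)) := by
  have hπ := Real.pi_pos
  have h := intervalIntegral.norm_integral_le_of_norm_le (μ := MeasureTheory.volume)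
    (f := fun s => γ.singIntegrand q t (t + s)) (a := -Real.pi) (b := Real.pi)
    (g := fun s => C * (γ.V / γ.c) * |s| ^ (σ - 1)) (by linarith)
    (Eventually.of_forall fun s hs => ?_)
    ((intervalIntegrable_abs_rpow (by linarith) _ _).const_mul _)
  · rwa [intervalIntegral.integral_const_mul, integral_abs_rpow (by linarith) hπ.le,
      sub_add_cancel] at h
  · have : |t + s - t| ≤ 3 * Real.pi / 2 := by
      rw [add_sub_cancel_left, abs_le]
      constructor <;> linarith [hs.1, hs.2]
    simpa using norm_singIntegrand_le (γ := γ) hq this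

/-- Far from both points, the difference of the two integrands is, up to a multiple of the kernel,
of the size of `δ |s - t| ^ (σ - 2)`. -/
theorem norm_far_le (hq : IsHolder q C σ) (hσ1 : σ < 1) {t u δ s : ℝ}
    (hδ : |u - t| = δ) (hs : 2 * δ ≤ |s - t|) (hs0 : 0 < |s - t|)
    (hst : |s - t| ≤ 3 * Real.pi / 2) (hsu : |s - u| ≤ 3 * Real.pi / 2) :
    ‖γ.singIntegrand q t s - γ.singIntegrand q u s - (q u - q t) * γ.cauchyKernel s t‖ ≤
      C * (γ.V / γ.c) ^ 2 * 2 ^ (1 - σ) * δ * |s - t| ^ (σ - 2) := by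
  have hc := γ.c_pos
  have hV := γ.V_nonneg
  have hC := hq.nonneg
  have hsu' : |s - t| / 2 ≤ |s - u| := by
    have := abs_sub_le s u t
    linarith
  have hsu0 : 0 < |s - u| := by linarith
  have n1 := γ.p_sub_ne_zero (sub_ne_zero.mp (abs_pos.mp hs0)) hst
  have n2 := γ.p_sub_ne_zero (sub_ne_zero.mp (abs_pos.mp hsu0)) hsu
  have e : γ.singIntegrand q t s - γ.singIntegrand q u s - (q u - q t) * γ.cauchyKernel s t =
      (q s - q u) * (γ.v s * (γ.p t - γ.p u) / ((γ.p s - γ.p t) * (γ.p s - γ.p u))) := by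
    unfold singIntegrand cauchyKernel
    field_simp
    ring
  have h1 : ‖γ.p t - γ.p u‖ ≤ γ.V * δ := by
    rw [← hδ, abs_sub_comm]
    exact γ.norm_p_sub_le t u
  rw [e, norm_mul, norm_div, norm_mul, norm_mul]
  have hδ0 : 0 ≤ δ := hδ ▸ abs_nonneg _
  calc _ ≤ (C * |s - u| ^ σ) * (γ.V * (γ.V * δ) / ((γ.c * |s - t|) * (γ.c * |s - u|))) := by
        gcongr
        · exact hq.bound s u
        · exact γ.speed_le s
        · exact γ.chord s t hst
        · exact γ.chord s u hsu
    _ = C * (γ.V / γ.c) ^ 2 * δ * |s - u| ^ (σ - 1) * |s - t|⁻¹ := by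
        rw [Real.rpow_sub hsu0, Real.rpow_one]
        field_simp
    _ ≤ C * (γ.V / γ.c) ^ 2 * δ * (|s - t| / 2) ^ (σ - 1) * |s - t|⁻¹ := by
        gcongr 1
        refine mul_le_mul_of_nonneg_left ?_ (by positivity)
        exact Real.rpow_le_rpow_of_nonpos (by positivity) hsu' (by linarith)
    _ = _ := by
        rw [Real.div_rpow hs0.le zero_le_two, show σ - 2 = σ - 1 - 1 by ring,
          Real.rpow_sub hs0 (σ - 1) 1, Real.rpow_one, show 1 - σ = -(σ - 1) by ring,
          Real.rpow_neg zero_le_two]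
        field_simp

end ChordArcLoop
end

/-! ### The theorems of Privalov and Sokhotski–Plemelj -/

noncomputable section
namespace ChordArcLoop

variable {γ : ChordArcLoop} {q : ℝ → ℂ} {C σ : ℝ}

/-- Privalov's estimate at small distances: near the two points each integrand is integrated
absolutely, far from them the kernels are compared by `norm_far_le`, and the multiple of the kernel
left over is integrated over a set symmetric about `t`, where its singular part cancels. -/
theorem norm_sing_sub_le_of_le (hq : IsHolder q C σ) (hσ : 0 < σ) (hσ1 : σ < 1) {t u δ : ℝ}
    (hδ : |u - t| = δ) (hδ0 : 0 < δ) (hδπ : 2 * δ ≤ Real.pi) :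
    ‖γ.sing q t - γ.sing q u‖ ≤ (C * (γ.V / γ.c) * (8 * (3 ^ σ / σ)) +
      2 * (C * (γ.V / γ.c) ^ 2 * 2 ^ (1 - σ)) * (2 ^ (σ - 1) / (1 - σ)) +
      C * (2 * (γ.L / γ.c)) * Real.pi) * δ ^ σ := by
  have hπ := Real.pi_pos
  have hc := γ.c_pos
  have hV := γ.V_nonneg
  have hL := γ.L_nonneg
  have hC := hq.nonneg
  have hu := abs_le.mp hδ.le
  set G : ℝ → ℂ := fun s => γ.singIntegrand q t s - γ.singIntegrand q u s with hG
  set H : ℝ → ℂ := fun s => G (t + s) + G (t - s) with hH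
  have hGi : ∀ a b, |a - t| ≤ Real.pi → |b - t| ≤ Real.pi →
      IntervalIntegrable G MeasureTheory.volume a b := by
    intro a b ha hb
    have ha' := abs_le.mp ha
    have hb' := abs_le.mp hb
    refine (intervalIntegrable_singIntegrand hq hσ ?_ ?_).sub
      (intervalIntegrable_singIntegrand hq hσ ?_ ?_) <;> rw [abs_le] <;> constructor <;> linarith
  have hG1 : ∀ a b, |a| ≤ Real.pi → |b| ≤ Real.pi →
      IntervalIntegrable (fun s => G (t + s)) MeasureTheory.volume a b := by
    intro a b ha hb
    have := (hGi (t + a) (t + b) (by simpa) (by simpa)).comp_add_left t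
    simpa using this
  have hG2 : ∀ a b, |a| ≤ Real.pi → |b| ≤ Real.pi →
      IntervalIntegrable (fun s => G (t - s)) MeasureTheory.volume a b := by
    intro a b ha hb
    have := (hGi (t - a) (t - b) (by simpa) (by simpa)).comp_sub_left t
    simpa using this
  have hHi : ∀ a b, |a| ≤ Real.pi → |b| ≤ Real.pi →
      IntervalIntegrable H MeasureTheory.volume a b := fun a b ha hb =>
    (hG1 a b ha hb).add (hG2 a b ha hb)
  have a0 : |(0 : ℝ)| ≤ Real.pi := by simpa using hπ.le
  have aδ : |2 * δ| ≤ Real.pi := by rw [abs_of_pos (by linarith)]; exact hδπ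
  have aπ : |Real.pi| ≤ Real.pi := by rw [abs_of_pos hπ]
  have aπ' : |-Real.pi| ≤ Real.pi := by rw [abs_neg, abs_of_pos hπ]
  have h1 : γ.sing q t - γ.sing q u =
      (∫ s in (0 : ℝ)..(2 * δ), H s) + ∫ s in (2 * δ)..Real.pi, H s := by
    rw [intervalIntegral.integral_add_adjacent_intervals (hHi _ _ a0 aδ) (hHi _ _ aδ aπ)]
    have e1 : γ.sing q t - γ.sing q u = ∫ s in (-Real.pi)..Real.pi, G (t + s) := by
      have i1 : IntervalIntegrable (fun s => γ.singIntegrand q t (t + s)) MeasureTheory.volume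
          (-Real.pi) Real.pi := by
        have := (intervalIntegrable_singIntegrand (γ := γ) (t := t) (a := t + -Real.pi)
          (b := t + Real.pi) hq hσ (by rw [abs_le]; constructor <;> linarith)
          (by rw [abs_le]; constructor <;> linarith)).comp_add_left t
        simpa using this
      have i2 : IntervalIntegrable (fun s => γ.singIntegrand q u (t + s)) MeasureTheory.volume
          (-Real.pi) Real.pi := by
        have := (intervalIntegrable_singIntegrand (γ := γ) (t := u) (a := t + -Real.pi)
          (b := t + Real.pi) hq hσ (by rw [abs_le]; constructor <;> linarith)
          (by rw [abs_le]; constructor <;> linarith)).comp_add_left t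
        simpa using this
      rw [sing_eq hq t t, sing_eq hq u t, ← intervalIntegral.integral_sub i1 i2]
    rw [e1, ← intervalIntegral.integral_add_adjacent_intervals (hG1 _ 0 aπ' a0) (hG1 0 _ a0 aπ),
      add_comm]
    have e2 := intervalIntegral.integral_comp_neg (a := 0) (b := Real.pi) (fun s => G (t + s))
    rw [neg_zero] at e2
    rw [← e2, ← intervalIntegral.integral_add (hG1 _ _ a0 aπ)]
    · rfl
    · exact hG2 _ _ a0 aπ
  -- the two points are within `δ` of the centre `t`
  have near : ‖∫ s in (0 : ℝ)..(2 * δ), H s‖ ≤ C * (γ.V / γ.c) * (8 * (3 ^ σ / σ)) * δ ^ σ := by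
    set K := C * (γ.V / γ.c)
    have hK : 0 ≤ K := by positivity
    set r := σ - 1
    have hr : -1 < r := by simp only [r]; linarith
    have hi := fun x => intervalIntegrable_abs_sub_rpow hr x 0 (2 * δ)
    have := intervalIntegral.norm_integral_le_of_norm_le (μ := MeasureTheory.volume)
      (f := H) (a := 0) (b := 2 * δ)
      (g := fun s => K * (|s - 0| ^ r + |s - (u - t)| ^ r + (|s - 0| ^ r + |s - (t - u)| ^ r)))
      (by linarith) (Eventually.of_forall fun s hs => ?_)
      ((((hi _).add (hi _)).add ((hi _).add (hi _))).const_mul _)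
    · refine this.trans ?_
      rw [intervalIntegral.integral_const_mul,
        intervalIntegral.integral_add ((hi _).add (hi _)) ((hi _).add (hi _)),
        intervalIntegral.integral_add (hi _) (hi _), intervalIntegral.integral_add (hi _) (hi _)]
      have b0 := integral_abs_sub_rpow_le hr hδ0.le (x := 0) (by simpa using hδ0.le)
      have b1 := integral_abs_sub_rpow_le hr hδ0.le (x := u - t) hδ.le
      have b2 := integral_abs_sub_rpow_le hr hδ0.le (x := t - u) (by rw [abs_sub_comm]; exact hδ.le)
      have e : r + 1 = σ := by simp only [r]; ring
      rw [e, Real.mul_rpow (by norm_num) hδ0.le] at b0 b1 b2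
      calc _ ≤ K * (2 * (3 ^ σ * δ ^ σ / σ) + 2 * (3 ^ σ * δ ^ σ / σ) +
            (2 * (3 ^ σ * δ ^ σ / σ) + 2 * (3 ^ σ * δ ^ σ / σ))) := by gcongr
        _ = _ := by ring
    · have hs1 := hs.1
      have hs2 := hs.2
      have d1 := norm_singIntegrand_le (γ := γ) hq (t := t) (s := t + s)
        (by rw [abs_le]; constructor <;> linarith)
      have d2 := norm_singIntegrand_le (γ := γ) hq (t := u) (s := t + s)
        (by rw [abs_le]; constructor <;> linarith)
      have d3 := norm_singIntegrand_le (γ := γ) hq (t := t) (s := t - s)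
        (by rw [abs_le]; constructor <;> linarith)
      have d4 := norm_singIntegrand_le (γ := γ) hq (t := u) (s := t - s)
        (by rw [abs_le]; constructor <;> linarith)
      rw [show t + s - t = s - 0 by ring] at d1
      rw [show t + s - u = s - (u - t) by ring] at d2
      rw [show t - s - t = -(s - 0) by ring, abs_neg] at d3
      rw [show t - s - u = -(s - (t - u)) by ring, abs_neg] at d4
      calc ‖H s‖ ≤ (‖γ.singIntegrand q t (t + s)‖ + ‖γ.singIntegrand q u (t + s)‖) +
            (‖γ.singIntegrand q t (t - s)‖ + ‖γ.singIntegrand q u (t - s)‖) :=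
            (norm_add_le _ _).trans (add_le_add (norm_sub_le _ _) (norm_sub_le _ _))
        _ ≤ _ := by
            rw [mul_add, mul_add, mul_add]
            gcongr
  have far : ‖∫ s in (2 * δ)..Real.pi, H s‖ ≤
      (2 * (C * (γ.V / γ.c) ^ 2 * 2 ^ (1 - σ)) * (2 ^ (σ - 1) / (1 - σ)) +
      C * (2 * (γ.L / γ.c)) * Real.pi) * δ ^ σ := by
    set K := C * (γ.V / γ.c) ^ 2 * 2 ^ (1 - σ)
    have hK : 0 ≤ K := by positivity
    have h0 : (0 : ℝ) ∉ uIcc (2 * δ) Real.pi := by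
      rw [uIcc_of_le hδπ]
      intro h
      linarith [h.1]
    have hi : IntervalIntegrable (fun s : ℝ => s ^ (σ - 2)) MeasureTheory.volume
        (2 * δ) Real.pi := intervalIntegral.intervalIntegrable_rpow (Or.inr h0)
    have := intervalIntegral.norm_integral_le_of_norm_le (μ := MeasureTheory.volume)
      (f := H) (a := 2 * δ) (b := Real.pi)
      (g := fun s => 2 * K * δ * s ^ (σ - 2) + C * δ ^ σ * (2 * (γ.L / γ.c)))
      hδπ (Eventually.of_forall fun s hs => ?_)
      ((hi.const_mul _).add intervalIntegrable_const)
    · refine this.trans ?_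
      rw [intervalIntegral.integral_add (hi.const_mul _) intervalIntegrable_const,
        intervalIntegral.integral_const_mul, intervalIntegral.integral_const, smul_eq_mul,
        integral_rpow (Or.inr ⟨by linarith, h0⟩), show σ - 2 + 1 = σ - 1 by ring]
      have e1 : (Real.pi ^ (σ - 1) - (2 * δ) ^ (σ - 1)) / (σ - 1) ≤
          (2 * δ) ^ (σ - 1) / (1 - σ) := by
        rw [← neg_div_neg_eq]
        have : 0 < Real.pi ^ (σ - 1) := by positivity
        have : 0 < 1 - σ := by linarith
        rw [show -(σ - 1) = 1 - σ by ring]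
        gcongr
        linarith
      have e2 : (2 * δ) ^ (σ - 1) * δ = 2 ^ (σ - 1) * δ ^ σ := by
        rw [Real.mul_rpow zero_le_two hδ0.le, Real.rpow_sub hδ0 σ 1, Real.rpow_one]
        field_simp
      calc _ ≤ 2 * K * δ * ((2 * δ) ^ (σ - 1) / (1 - σ)) +
            Real.pi * (C * δ ^ σ * (2 * (γ.L / γ.c))) := by
            gcongr
            linarith
        _ = 2 * K * ((2 * δ) ^ (σ - 1) * δ / (1 - σ)) +
            Real.pi * (C * δ ^ σ * (2 * (γ.L / γ.c))) := by ring
        _ = _ := by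
            rw [e2]
            ring
    · have hs1 := hs.1
      have hs2 := hs.2
      have hs0 : 0 < s := by linarith
      have c1 : t + s - t = s := by ring
      have c2 : |t + s - t| = s := by rw [c1, abs_of_pos hs0]
      have c3 : |t - s - t| = s := by rw [show t - s - t = -s by ring, abs_neg, abs_of_pos hs0]
      have f1 := norm_far_le (γ := γ) hq hσ1 (s := t + s) hδ (by rw [c2]; exact hs1.le)
        (by rw [c2]; exact hs0) (by rw [c2]; linarith) (by rw [abs_le]; constructor <;> linarith)
      have f2 := norm_far_le (γ := γ) hq hσ1 (s := t - s) hδ (by rw [c3]; exact hs1.le)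
        (by rw [c3]; exact hs0) (by rw [c3]; linarith) (by rw [abs_le]; constructor <;> linarith)
      rw [c2] at f1
      rw [c3] at f2
      have k1 := γ.norm_cauchyKernel_sub_inv_le (s := t + s) (t := t) (by linarith)
        (by rw [c2]; linarith)
      have k2 := γ.norm_cauchyKernel_sub_inv_le (s := t - s) (t := t) (by linarith)
        (by rw [c3]; linarith)
      have e : H s = (G (t + s) - (q u - q t) * γ.cauchyKernel (t + s) t) +
          (G (t - s) - (q u - q t) * γ.cauchyKernel (t - s) t) +
          (q u - q t) * ((γ.cauchyKernel (t + s) t - ((t + s - t : ℝ) : ℂ)⁻¹) +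
            (γ.cauchyKernel (t - s) t - ((t - s - t : ℝ) : ℂ)⁻¹)) := by
        rw [c1, show t - s - t = -s by ring, Complex.ofReal_neg, inv_neg]
        simp only [hH]
        ring
      rw [e]
      have hqq : ‖q u - q t‖ ≤ C * δ ^ σ := by
        rw [← hδ]
        exact hq.bound u t
      calc _ ≤ (K * δ * s ^ (σ - 2) + K * δ * s ^ (σ - 2)) +
            C * δ ^ σ * (γ.L / γ.c + γ.L / γ.c) := by
            refine (norm_add_le _ _).trans (add_le_add
              ((norm_add_le _ _).trans (add_le_add f1 f2)) ?_)
            rw [norm_mul]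
            gcongr
            exact (norm_add_le _ _).trans (add_le_add k1 k2)
        _ = _ := by ring
  rw [h1]
  calc _ ≤ _ := (norm_add_le _ _).trans (add_le_add near far)
    _ = _ := by ring

/-- **Privalov's theorem**: the singular Cauchy integral preserves Hölder classes. -/
theorem exists_isHolder_sing (hq : IsHolder q C σ) (hσ : 0 < σ) (hσ1 : σ < 1) :
    ∃ C', IsHolder (γ.sing q) C' σ := by
  have hπ := Real.pi_pos
  have hC := hq.nonneg
  have hV := γ.V_nonneg
  have hc := γ.c_pos
  have hL := γ.L_nonneg
  obtain ⟨A, hA⟩ : ∃ A, ∀ t u, 0 < |u - t| → 2 * |u - t| ≤ Real.pi →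
      ‖γ.sing q t - γ.sing q u‖ ≤ A * |u - t| ^ σ :=
    ⟨_, fun t u h0 hπ => norm_sing_sub_le_of_le hq hσ hσ1 rfl h0 hπ⟩
  set M := C * (γ.V / γ.c) * (2 * (Real.pi ^ σ / σ)) with hM
  have hM0 : 0 ≤ M := by positivity
  refine ⟨max A (2 * M / (Real.pi / 2) ^ σ), periodic_sing hq, fun t u => ?_⟩
  rcases eq_or_ne t u with rfl | htu
  · simp [Real.zero_rpow hσ.ne']
  rw [abs_sub_comm]
  rcases le_or_gt (2 * |u - t|) Real.pi with h | h
  · refine (hA t u (abs_pos.mpr (sub_ne_zero.mpr htu.symm)) h).trans ?_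
    gcongr
    exact le_max_left _ _
  · have h1 : (Real.pi / 2) ^ σ ≤ |u - t| ^ σ := by
      gcongr
      linarith
    calc _ ≤ M + M := (norm_sub_le _ _).trans
          (add_le_add (norm_sing_le hq hσ t) (norm_sing_le hq hσ u))
      _ = 2 * M / (Real.pi / 2) ^ σ * (Real.pi / 2) ^ σ := by field_simp; ring
      _ ≤ _ := by
        gcongr
        exact le_max_right _ _

/-- A nearest point of the curve to `z`, with a parameter within half a period of `t`. -/
theorem exists_nearest (γ : ChordArcLoop) (t : ℝ) (z : ℂ) :
    ∃ u, |t - u| ≤ Real.pi ∧ ∀ s, ‖γ.p u - z‖ ≤ ‖γ.p s - z‖ := by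
  have hπ := Real.pi_pos
  obtain ⟨u, hu, hmin⟩ := (isCompact_Icc (a := t - Real.pi) (b := t + Real.pi)).exists_isMinOn
    (nonempty_Icc.mpr (by linarith))
    ((γ.continuous_p.sub continuous_const).norm.continuousOn : ContinuousOn
      (fun s => ‖γ.p s - z‖) _)
  refine ⟨u, ?_, fun s => ?_⟩
  · rw [abs_le]
    constructor <;> linarith [hu.1, hu.2]
  · obtain ⟨y, hy, hys⟩ := γ.periodic_p.exists_mem_Ico (by positivity) s (t - Real.pi)
    rw [hys]
    exact hmin ⟨hy.1, by linarith [hy.2]⟩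

/-- The **Sokhotski–Plemelj formula**: where the curve winds `N / (2πi)` times, the
(unnormalized) Cauchy integral has the boundary values `N q + sing q`. The integral is centred at
a nearest point of the curve, where dominated convergence applies by the chord-arc condition. -/
theorem tendsto_cauchyIntegral (hq : IsHolder q C σ) (hσ : 0 < σ) {S : Set ℂ}
    (hS : ∀ z ∈ S, ∀ t, γ.p t ≠ z) {N : ℂ}
    (hN : ∀ z ∈ S, ∫ s in (0 : ℝ)..(2 * Real.pi), γ.v s / (γ.p s - z) = N) (t : ℝ) :
    Tendsto (fun z => ∫ s in (0 : ℝ)..(2 * Real.pi), q s * (γ.v s / (γ.p s - z)))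
      (𝓝[S] (γ.p t)) (𝓝 (N * q t + γ.sing q t)) := by
  have hπ := Real.pi_pos
  have hc := γ.c_pos
  have hC := hq.nonneg
  have hV := γ.V_nonneg
  choose u hu hmin using γ.exists_nearest t
  have hchord : ∀ z s, |s| ≤ Real.pi → γ.c / 2 * |s| ≤ ‖γ.p (u z + s) - z‖ := by
    intro z s hs
    have h1 := γ.chord (u z + s) (u z) (by rw [add_sub_cancel_left]; linarith)
    rw [add_sub_cancel_left] at h1
    have h2 : ‖γ.p (u z + s) - γ.p (u z)‖ ≤ ‖γ.p (u z + s) - z‖ + ‖γ.p (u z) - z‖ := by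
      rw [← norm_neg (γ.p (u z) - z)]
      refine (le_of_eq ?_).trans (norm_add_le _ _)
      congr 1
      ring
    have := hmin z (u z + s)
    linarith
  have hut : Tendsto u (𝓝 (γ.p t)) (𝓝 t) := by
    refine tendsto_iff_norm_sub_tendsto_zero.mpr ?_
    refine squeeze_zero (g := fun z => 2 / γ.c * ‖γ.p t - z‖) (fun _ => norm_nonneg _)
      (fun z => ?_) ?_
    · have := hchord z (t - u z) (hu z)
      rw [add_sub_cancel] at this
      rw [Real.norm_eq_abs, abs_sub_comm]
      calc |t - u z| = 2 / γ.c * (γ.c / 2 * |t - u z|) := by field_simp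
        _ ≤ _ := by gcongr
    · have : Continuous fun z => 2 / γ.c * ‖γ.p t - z‖ := by fun_prop
      simpa using this.tendsto (γ.p t)
  have hper : ∀ f : ℝ → ℂ, Function.Periodic f (2 * Real.pi) → ∀ a,
      ∫ s in (0 : ℝ)..(2 * Real.pi), f s = ∫ s in (-Real.pi)..Real.pi, f (a + s) := by
    intro f hf a
    rw [intervalIntegral.integral_comp_add_left]
    have := hf.intervalIntegral_add_eq 0 (a + -Real.pi)
    convert this using 2 <;> ring
  have hcont : ∀ z ∈ S, Continuous fun s => γ.v s / (γ.p s - z) := fun z hz =>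
    γ.continuous_v.div (γ.continuous_p.sub continuous_const)
      fun s => sub_ne_zero.mpr (hS z hz s)
  have hkper : ∀ z, Function.Periodic (fun s => γ.v s / (γ.p s - z)) (2 * Real.pi) := by
    intro z s
    simp only [γ.periodic_p s, γ.periodic_v s]
  have hqc := hq.continuous hσ
  have key : ∀ z ∈ S, (∫ s in (0 : ℝ)..(2 * Real.pi), q s * (γ.v s / (γ.p s - z))) =
      N * q (u z) + ∫ s in (-Real.pi)..Real.pi,
        (q (u z + s) - q (u z)) * (γ.v (u z + s) / (γ.p (u z + s) - z)) := by
    intro z hz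
    rw [← hN z hz, mul_comm _ (q (u z)), ← intervalIntegral.integral_const_mul,
      hper (fun s => q s * (γ.v s / (γ.p s - z))) (hq.periodic.mul (hkper z)) (u z),
      hper (fun s => q (u z) * (γ.v s / (γ.p s - z))) (fun s => by simp only [hkper z s]) (u z),
      ← intervalIntegral.integral_add]
    · refine intervalIntegral.integral_congr fun s _ => ?_
      ring
    · exact (continuous_const.mul
        ((hcont z hz).comp (continuous_const_add (u z)))).intervalIntegrable _ _
    · exact (((hqc.comp (continuous_const_add (u z))).sub continuous_const).mul
        ((hcont z hz).comp (continuous_const_add (u z)))).intervalIntegrable _ _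
  refine Tendsto.congr' (f₁ := fun z => N * q (u z) + ∫ s in (-Real.pi)..Real.pi,
        (q (u z + s) - q (u z)) * (γ.v (u z + s) / (γ.p (u z + s) - z))) ?_ ?_
  · filter_upwards [self_mem_nhdsWithin] with z hz
    exact (key z hz).symm
  have hut' : Tendsto u (𝓝[S] (γ.p t)) (𝓝 t) := hut.mono_left nhdsWithin_le_nhds
  refine Tendsto.add (((hqc.tendsto t).comp hut').const_mul N) ?_
  unfold sing
  refine intervalIntegral.tendsto_integral_filter_of_dominated_convergence
    (fun s => C * (γ.V / (γ.c / 2)) * |s| ^ (σ - 1)) ?_ ?_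
    ((intervalIntegrable_abs_rpow (by linarith) _ _).const_mul _) ?_
  · filter_upwards [self_mem_nhdsWithin] with z hz
    exact (((hqc.comp (continuous_const_add (u z))).sub continuous_const).mul
        ((hcont z hz).comp (continuous_const_add (u z)))).aestronglyMeasurable
  · filter_upwards [self_mem_nhdsWithin] with z hz
    refine Eventually.of_forall fun s hs => ?_
    rw [uIoc_of_le (by linarith)] at hs
    have hs' : |s| ≤ Real.pi := abs_le.mpr ⟨hs.1.le, hs.2⟩
    rcases eq_or_ne s 0 with rfl | h0
    · simp only [add_zero, sub_self, zero_mul, norm_zero]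
      positivity
    have h2 : 0 < |s| := abs_pos.mpr h0
    rw [norm_mul, norm_div]
    have hb := hq.bound (u z + s) (u z)
    rw [add_sub_cancel_left] at hb
    calc _ ≤ (C * |s| ^ σ) * (γ.V / (γ.c / 2 * |s|)) := by
          gcongr
          · exact γ.speed_le _
          · exact hchord z s hs'
      _ = _ := by
        rw [Real.rpow_sub h2, Real.rpow_one]
        field_simp
  · have hne : ∀ᵐ s : ℝ, s ≠ 0 := by
      simp [MeasureTheory.ae_iff, MeasureTheory.measure_singleton]
    filter_upwards [hne] with s h0 hs
    rw [uIoc_of_le (by linarith)] at hs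
    have hs' : |s| ≤ Real.pi := abs_le.mpr ⟨hs.1.le, hs.2⟩
    have h3 : Tendsto (fun z => u z + s) (𝓝[S] (γ.p t)) (𝓝 (t + s)) := hut'.add_const s
    refine Tendsto.mul (((hqc.tendsto _).comp h3).sub ((hqc.tendsto _).comp hut'))
      (Tendsto.div ((γ.continuous_v.tendsto _).comp h3)
        (((γ.continuous_p.tendsto _).comp h3).sub
          (tendsto_id.mono_left nhdsWithin_le_nhds)) ?_)
    exact γ.p_sub_ne_zero (by simpa using h0) (by rw [add_sub_cancel_left]; linarith)

end ChordArcLoop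
end

/-! ### Univalent functions and Cauchy type integrals -/

noncomputable section

/-- An injective holomorphic function has nonvanishing derivative: its inverse is continuous by the
open mapping theorem and holomorphic off the isolated images of critical points, hence
holomorphic. -/
theorem Complex.deriv_ne_zero_of_injOn {f : ℂ → ℂ} {U : Set ℂ} (hU : IsOpen U)
    (hf : DifferentiableOn ℂ f U) (hi : InjOn f U) {z₀ : ℂ} (hz₀ : z₀ ∈ U) : deriv f z₀ ≠ 0 := by
  intro h0
  have hnc : ∀ z ∈ U, ¬ ∀ᶠ w in 𝓝 z, f w = f z := by
    intro z hz h
    have h1 : ∀ᶠ w in 𝓝 z, w = z := by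
      filter_upwards [h, hU.mem_nhds hz] with w hw hwU
      exact hi hwU hz hw
    have h2 : ∀ᶠ w in 𝓝[≠] z, False := by
      filter_upwards [nhdsWithin_le_nhds h1, self_mem_nhdsWithin] with w hw hw'
      exact hw' hw
    exact h2.exists.choose_spec
  have han : ∀ z ∈ U, AnalyticAt ℂ f z := fun z hz => hf.analyticAt (hU.mem_nhds hz)
  have hop : ∀ z ∈ U, 𝓝 (f z) ≤ map f (𝓝 z) := fun z hz =>
    (han z hz).eventually_constant_or_nhds_le_map_nhds.resolve_left (hnc z hz)
  set g := Function.invFunOn f U with hg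
  have hgl : ∀ z ∈ U, g (f z) = z := fun z hz => hi.leftInvOn_invFunOn hz
  have hfg : ∀ z ∈ U, ∀ᶠ y in 𝓝 (f z), g y ∈ U ∧ f (g y) = y := by
    intro z hz
    filter_upwards [hop z hz (image_mem_map (hU.mem_nhds hz))] with y hy
    exact ⟨Function.invFunOn_mem hy, Function.invFunOn_eq hy⟩
  have hgc : ∀ z ∈ U, ContinuousAt g (f z) := by
    intro z hz
    rw [ContinuousAt, hgl z hz]
    intro W hW
    have := hop z hz (image_mem_map (inter_mem hW (hU.mem_nhds hz)))
    refine mem_map.mpr ?_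
    filter_upwards [this] with y hy
    obtain ⟨w, ⟨hw, hwU⟩, rfl⟩ := hy
    rwa [mem_preimage, hgl w hwU]
  have hne : ∀ᶠ z in 𝓝[≠] z₀, deriv f z ≠ 0 := by
    refine (han z₀ hz₀).deriv.eventually_eq_zero_or_eventually_ne_zero.resolve_left fun h => ?_
    obtain ⟨ε, hε, hb⟩ := Metric.eventually_nhds_iff_ball.mp (h.and (hU.mem_nhds hz₀))
    refine hnc z₀ hz₀ ?_
    filter_upwards [Metric.ball_mem_nhds z₀ hε] with w hw
    exact Metric.isOpen_ball.is_const_of_deriv_eq_zero (convex_ball z₀ ε).isPreconnected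
      (hf.mono fun x hx => (hb x hx).2) (fun x hx => (hb x hx).1) hw (Metric.mem_ball_self hε)
  have hgd : ∀ᶠ y in 𝓝[≠] (f z₀), DifferentiableAt ℂ g y := by
    have ht : Tendsto g (𝓝[≠] (f z₀)) (𝓝[≠] z₀) := by
      refine tendsto_nhdsWithin_iff.mpr ⟨?_, ?_⟩
      · have := hgc z₀ hz₀
        rw [ContinuousAt, hgl z₀ hz₀] at this
        exact this.mono_left nhdsWithin_le_nhds
      · filter_upwards [nhdsWithin_le_nhds (hfg z₀ hz₀), self_mem_nhdsWithin] with y hy hy' h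
        rw [mem_singleton_iff] at h
        rw [h] at hy
        exact hy' hy.2.symm
    filter_upwards [nhdsWithin_le_nhds (hfg z₀ hz₀), ht.eventually hne] with y hy hy'
    have h1 := hgc (g y) hy.1
    have h2 := hfg (g y) hy.1
    rw [hy.2] at h1 h2
    exact (HasDerivAt.of_local_left_inverse h1 (han (g y) hy.1).differentiableAt.hasDerivAt hy'
      (h2.mono fun _ h => h.2)).differentiableAt
  have hga := Complex.analyticAt_of_differentiable_on_punctured_nhds_of_continuousAt hgd
    (hgc z₀ hz₀)
  refine not_differentiableAt_of_local_left_inverse_hasDerivAt_zero (f := f) (g := g)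
    (a := f z₀) ?_ ((hfg z₀ hz₀).mono fun _ h => h.2) hga.differentiableAt
  rw [hgl z₀ hz₀, ← h0]
  exact (han z₀ hz₀).differentiableAt.hasDerivAt

/-- Cauchy type integrals are holomorphic off the curve of integration. -/
theorem hasDerivAt_cauchyType {φ P : ℝ → ℂ} (hφ : Continuous φ) (hP : Continuous P) {a b : ℝ}
    {z : ℂ} (hz : ∀ s, P s ≠ z) :
    HasDerivAt (fun z => ∫ s in a..b, φ s / (P s - z)) (∫ s in a..b, φ s / (P s - z) ^ 2) z := by
  obtain ⟨s₀, -, hs₀⟩ := (isCompact_uIcc (a := a) (b := b)).exists_isMinOn nonempty_uIcc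
    ((hP.sub continuous_const).norm.continuousOn : ContinuousOn (fun s => ‖P s - z‖) _)
  set m := ‖P s₀ - z‖ with hm
  have hm0 : 0 < m := norm_pos_iff.mpr (sub_ne_zero.mpr (hz s₀))
  have hmin : ∀ s ∈ uIcc a b, ∀ x ∈ Metric.ball z (m / 2), m / 2 ≤ ‖P s - x‖ := by
    intro s hs x hx
    have h1 : m ≤ ‖P s - z‖ := hs₀ hs
    have h2 : ‖P s - z‖ ≤ ‖P s - x‖ + ‖x - z‖ := by
      simpa using norm_add_le (P s - x) (x - z)
    rw [mem_ball_iff_norm] at hx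
    linarith
  refine (intervalIntegral.hasDerivAt_integral_of_dominated_loc_of_deriv_le
    (F := fun x s => φ s / (P s - x)) (F' := fun x s => φ s / (P s - x) ^ 2)
    (bound := fun s => ‖φ s‖ / (m / 2) ^ 2)
    (Metric.ball_mem_nhds z (half_pos hm0)) ?_ ?_ ?_ ?_ ?_ ?_).2
  · exact Eventually.of_forall fun x => (hφ.measurable.div
      (hP.measurable.sub_const x)).aestronglyMeasurable
  · exact (hφ.div (hP.sub continuous_const)
      fun s => sub_ne_zero.mpr (hz s)).intervalIntegrable _ _
  · exact (hφ.measurable.div ((hP.measurable.sub_const z).pow_const 2)).aestronglyMeasurable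
  · refine Eventually.of_forall fun s hs x hx => ?_
    have := hmin s (uIoc_subset_uIcc hs) x hx
    rw [norm_div, norm_pow]
    gcongr
  · exact (hφ.norm.div_const _).intervalIntegrable _ _
  · refine Eventually.of_forall fun s hs x hx => ?_
    have h1 := hmin s (uIoc_subset_uIcc hs) x hx
    have h2 : P s - x ≠ 0 := norm_pos_iff.mp (by linarith)
    have h3 := (((hasDerivAt_id x).const_sub (P s)).inv h2).const_mul (φ s)
    simpa [div_eq_mul_inv] using h3

theorem exists_norm_sub_ge_of_injOn {f : ℂ → ℂ} {U K : Set ℂ} (hU : IsOpen U)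
    (hf : DifferentiableOn ℂ f U) (hi : InjOn f U) (hK : IsCompact K) (hKU : K ⊆ U) :
    ∃ c > 0, ∀ x ∈ K, ∀ y ∈ K, c * ‖x - y‖ ≤ ‖f x - f y‖ := by
  have key : ∃ c > 0, ∀ x ∈ K ×ˢ K, c * ‖x.1 - x.2‖ ≤ ‖f x.1 - f x.2‖ := by
    refine (hK.prod hK).induction_on (p := fun S => ∃ c > 0, ∀ x ∈ S,
      c * ‖x.1 - x.2‖ ≤ ‖f x.1 - f x.2‖) ⟨1, one_pos, by simp⟩ ?_ ?_ ?_
    · rintro S T hST ⟨c, hc, h⟩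
      exact ⟨c, hc, fun x hx => h x (hST hx)⟩
    · rintro S T ⟨c, hc, h⟩ ⟨c', hc', h'⟩
      refine ⟨min c c', lt_min hc hc', fun x hx => ?_⟩
      rcases hx with hx | hx
      · exact le_trans (by gcongr; exact min_le_left _ _) (h x hx)
      · exact le_trans (by gcongr; exact min_le_right _ _) (h' x hx)
    · rintro ⟨a, b⟩ ⟨ha, hb⟩
      simp only at ha hb
      rcases eq_or_ne a b with rfl | hab
      · have hd := (hf.analyticAt (hU.mem_nhds (hKU ha))).hasStrictDerivAt
        have hd0 := Complex.deriv_ne_zero_of_injOn hU hf hi (hKU ha)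
        have hpos : 0 < ‖deriv f a‖ / 2 := half_pos (norm_pos_iff.mpr hd0)
        refine ⟨_, nhdsWithin_le_nhds (hd.isLittleO.def hpos), ‖deriv f a‖ / 2, hpos,
          fun x hx => ?_⟩
        simp only [mem_ofPred_eq, ContinuousLinearMap.toSpanSingleton_apply, smul_eq_mul] at hx
        have h1 : ‖(x.1 - x.2) * deriv f a‖ ≤ ‖f x.1 - f x.2‖ +
            ‖f x.1 - f x.2 - (x.1 - x.2) * deriv f a‖ := by
          rw [← norm_neg (f x.1 - f x.2 - _)]
          refine (le_of_eq ?_).trans (norm_add_le _ _)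
          congr 1
          ring
        rw [norm_mul] at h1
        linarith
      · set m := ‖f a - f b‖ with hm
        have hm0 : 0 < m := norm_pos_iff.mpr
          (sub_ne_zero.mpr fun h => hab (hi (hKU ha) (hKU hb) h))
        have hl0 : 0 < ‖a - b‖ := norm_pos_iff.mpr (sub_ne_zero.mpr hab)
        have hfa : ∀ x ∈ K, ContinuousAt f x := fun x hx =>
          (hf.analyticAt (hU.mem_nhds (hKU hx))).continuousAt
        have c1 : ContinuousAt (fun x : ℂ × ℂ => ‖f x.1 - f x.2‖) (a, b) :=
          (((hfa a ha).comp_of_eq continuousAt_fst rfl).sub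
            ((hfa b hb).comp_of_eq continuousAt_snd rfl)).norm
        have c2 : ContinuousAt (fun x : ℂ × ℂ => ‖x.1 - x.2‖) (a, b) := by fun_prop
        have e1 := c1.eventually (lt_mem_nhds (half_lt_self hm0))
        have e2 := c2.eventually (gt_mem_nhds (lt_two_mul_self hl0))
        refine ⟨_, nhdsWithin_le_nhds (e1.and e2), m / 2 / (2 * ‖a - b‖), by positivity,
          fun x hx => ?_⟩
        calc m / 2 / (2 * ‖a - b‖) * ‖x.1 - x.2‖ ≤ m / 2 / (2 * ‖a - b‖) * (2 * ‖a - b‖) := by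
              gcongr
              exact hx.2.le
          _ = m / 2 := by field_simp
          _ ≤ _ := hx.1.le
  obtain ⟨c, hc, h⟩ := key
  exact ⟨c, hc, fun x hx y hy => h (x, y) ⟨hx, hy⟩⟩

theorem norm_circleMap_sub_ge {s t : ℝ} (h : |s - t| ≤ 3 * Real.pi / 2) :
    2 / (3 * Real.pi) * |s - t| ≤ ‖circleMap 0 1 s - circleMap 0 1 t‖ := by
  have hπ := Real.pi_pos
  have e1 : circleMap 0 1 s - circleMap 0 1 t =
      circleMap 0 1 t * (Complex.exp (Complex.I * ((s - t : ℝ) : ℂ)) - 1) := by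
    simp only [circleMap_zero, Complex.ofReal_one, one_mul]
    rw [mul_sub, ← Complex.exp_add, mul_one]
    congr 2
    push_cast
    ring
  rw [e1, norm_mul, Complex.norm_exp_I_mul_ofReal_sub_one, norm_circleMap_zero, abs_one, one_mul,
    norm_mul, Real.norm_eq_abs, Real.norm_eq_abs, abs_two]
  set x := |s - t| / 2 with hx
  have hx0 : 0 ≤ x := by positivity
  have e2 : |Real.sin ((s - t) / 2)| = |Real.sin x| := by
    rcases abs_cases (s - t) with ⟨h1, -⟩ | ⟨h1, -⟩
    · rw [hx, h1]
    · rw [hx, h1, neg_div, Real.sin_neg, abs_neg]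
  have e3 : |s - t| = 2 * x := by rw [hx]; ring
  rw [e2, e3]
  rw [e3] at h
  have key : 2 / (3 * Real.pi) * x ≤ Real.sin x := by
    rcases le_or_gt x (Real.pi / 2) with h1 | h1
    · refine le_trans ?_ (Real.mul_le_sin hx0 h1)
      gcongr
      linarith
    · rw [← Real.sin_pi_sub]
      refine le_trans ?_ (Real.mul_le_sin (by linarith) (by linarith))
      rw [div_mul_eq_mul_div, div_mul_eq_mul_div, div_le_div_iff₀ (by positivity) hπ]
      nlinarith
  have := le_abs_self (Real.sin x)
  linarith
end

/-! ### The boundary curve as a chord-arc loop -/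

noncomputable section
namespace AnalyticJordanDomain

variable (D : AnalyticJordanDomain)

theorem hasDerivAt_point (θ : ℝ) :
    HasDerivAt (fun θ => (D.point θ : ℂ)) (D.velocity θ) θ := by
  obtain ⟨U, hU, hS, hd, -⟩ := D.univalent
  have h1 : HasDerivAt D.param (deriv D.param (circleMap 0 1 θ)) (circleMap 0 1 θ) :=
    (hd.differentiableAt (hU.mem_nhds (hS (circleMap_mem_sphere 0 zero_le_one θ)))).hasDerivAt
  have h2 := h1.comp θ (hasDerivAt_circleMap 0 1 θ)
  refine h2.congr_deriv ?_
  rw [velocity]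
  ring

theorem periodic_point : Function.Periodic (fun θ => (D.point θ : ℂ)) (2 * Real.pi) := by
  intro θ
  simp only [point, periodic_circleMap 0 1 θ]

theorem periodic_velocity : Function.Periodic D.velocity (2 * Real.pi) := by
  intro θ
  simp only [velocity, periodic_circleMap 0 1 θ]

theorem exists_norm_velocity_le : ∃ V, ∀ t, ‖D.velocity t‖ ≤ V := by
  obtain ⟨V, hV⟩ := (isCompact_Icc (a := (0 : ℝ)) (b := 2 * Real.pi)).exists_bound_of_continuousOn
    D.continuous_velocity.continuousOn
  refine ⟨V, fun t => ?_⟩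
  obtain ⟨y, hy, h⟩ := D.periodic_velocity.exists_mem_Ico₀ Real.two_pi_pos t
  rw [h]
  exact hV y ⟨hy.1, hy.2.le⟩

theorem exists_velocity_lipschitz : ∃ L, ∀ s t, ‖D.velocity s - D.velocity t‖ ≤ L * |s - t| := by
  obtain ⟨U, hU, hS, hd, -⟩ := D.univalent
  have hS' : ∀ θ, circleMap 0 1 θ ∈ U := fun θ => hS (circleMap_mem_sphere 0 zero_le_one θ)
  have hd1 := hd.deriv hU
  have hd2 := hd1.deriv hU
  set A : ℝ → ℂ := fun θ => Complex.I * (circleMap 0 1 θ * Complex.I) *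
    deriv D.param (circleMap 0 1 θ) + Complex.I * circleMap 0 1 θ *
      (deriv (deriv D.param) (circleMap 0 1 θ) * (circleMap 0 1 θ * Complex.I)) with hA
  have h1 : ∀ θ, HasDerivAt D.velocity (A θ) θ := by
    intro θ
    have e1 : HasDerivAt (deriv D.param) (deriv (deriv D.param) (circleMap 0 1 θ))
        (circleMap 0 1 θ) := (hd1.differentiableAt (hU.mem_nhds (hS' θ))).hasDerivAt
    exact ((hasDerivAt_circleMap 0 1 θ).const_mul Complex.I).mul
      (e1.comp θ (hasDerivAt_circleMap 0 1 θ))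
  have hc := continuous_circleMap 0 1
  have h2 : Continuous A := by
    have c1 := hd1.continuousOn.comp_continuous hc hS'
    have c2 := hd2.continuousOn.comp_continuous hc hS'
    have c0 : Continuous fun θ => circleMap 0 1 θ := hc
    exact ((continuous_const.mul (c0.mul continuous_const)).mul c1).add
      ((continuous_const.mul c0).mul (c2.mul (c0.mul continuous_const)))
  have h3 : Function.Periodic A (2 * Real.pi) := by
    intro θ
    simp only [hA, periodic_circleMap 0 1 θ]
  obtain ⟨L, hL⟩ := (isCompact_Icc (a := (0 : ℝ)) (b := 2 * Real.pi)).exists_bound_of_continuousOn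
    h2.continuousOn
  refine ⟨L, fun s t => Convex.norm_image_sub_le_of_norm_hasDerivWithin_le (s := univ)
    (fun x _ => (h1 x).hasDerivWithinAt) (fun x _ => ?_) convex_univ (mem_univ _) (mem_univ _)⟩
  obtain ⟨y, hy, h⟩ := h3.exists_mem_Ico₀ Real.two_pi_pos x
  rw [h]
  exact hL y ⟨hy.1, hy.2.le⟩

theorem exists_chord : ∃ c > 0, ∀ s t : ℝ, |s - t| ≤ 3 * Real.pi / 2 →
    c * |s - t| ≤ ‖(D.point s : ℂ) - D.point t‖ := by
  obtain ⟨U, hU, hS, hd, hi⟩ := D.univalent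
  obtain ⟨c, hc, h⟩ := exists_norm_sub_ge_of_injOn hU hd hi (isCompact_sphere 0 1) hS
  have hπ := Real.pi_pos
  refine ⟨c * (2 / (3 * Real.pi)), by positivity, fun s t hst => ?_⟩
  calc _ = c * (2 / (3 * Real.pi) * |s - t|) := by ring
    _ ≤ c * ‖circleMap 0 1 s - circleMap 0 1 t‖ := by
      gcongr
      exact norm_circleMap_sub_ge hst
    _ ≤ _ := h _ (circleMap_mem_sphere 0 zero_le_one s) _ (circleMap_mem_sphere 0 zero_le_one t)

/-- The boundary curve as a chord-arc loop. -/
def loop : ChordArcLoop where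
  p θ := D.point θ
  v := D.velocity
  L := D.exists_velocity_lipschitz.choose
  V := D.exists_norm_velocity_le.choose
  c := D.exists_chord.choose
  c_pos := D.exists_chord.choose_spec.1
  hasDerivAt := D.hasDerivAt_point
  periodic_p := D.periodic_point
  periodic_v := D.periodic_velocity
  lipschitz := D.exists_velocity_lipschitz.choose_spec
  speed_le := D.exists_norm_velocity_le.choose_spec
  chord := D.exists_chord.choose_spec.2

theorem exists_point_eq (x : D.curve) : ∃ θ, D.point θ = x := by
  obtain ⟨x, w, hw, rfl⟩ := x
  have hw' : w ∈ range (circleMap 0 1) := by rw [range_circleMap, abs_one]; exact hw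
  obtain ⟨θ, rfl⟩ := hw'
  exact ⟨θ, rfl⟩

theorem curve_eq_range : D.curve = range D.loop.p := by
  ext z
  constructor
  · intro hz
    obtain ⟨θ, hθ⟩ := D.exists_point_eq ⟨z, hz⟩
    exact ⟨θ, congrArg Subtype.val hθ⟩
  · rintro ⟨θ, rfl⟩
    exact (D.point θ).2

/-- A point of the curve has a parameter in every period. -/
theorem exists_point_eq_near (x : D.curve) (s : ℝ) : ∃ θ, D.point θ = x ∧ |s - θ| ≤ Real.pi := by
  obtain ⟨θ, rfl⟩ := D.exists_point_eq x
  have hper : Function.Periodic D.point (2 * Real.pi) := fun t => Subtype.ext (D.periodic_point t)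
  obtain ⟨y, hy, h⟩ := hper.exists_mem_Ico Real.two_pi_pos θ (s - Real.pi)
  refine ⟨y, h.symm, ?_⟩
  rw [abs_le]
  constructor <;> linarith [hy.1, hy.2]

/-- The pullback of a Hölder function on the curve to the parameter line. -/
theorem isHolder_comp_point {σ C : ℝ≥0} {F : D.curve → ℂ} (hF : HolderWith C σ F) :
    ∃ C', ChordArcLoop.IsHolder (fun θ => F (D.point θ)) C' σ := by
  have hV := D.loop.V_nonneg
  refine ⟨C * D.loop.V ^ (σ : ℝ), fun t => ?_, fun s t => ?_⟩
  · exact congrArg F (Subtype.ext (D.periodic_point t))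
  · rw [← dist_eq_norm]
    refine (hF.dist_le _ _).trans ?_
    rw [mul_assoc, ← Real.mul_rpow hV (abs_nonneg _)]
    gcongr
    rw [Subtype.dist_eq, dist_eq_norm]
    exact D.loop.norm_p_sub_le s t

/-- A periodic Hölder function of the parameter, pushed forward to the curve. -/
def pushforward (a : ℝ → ℂ) (x : D.curve) : ℂ := a (D.exists_point_eq x).choose

theorem pushforward_point {a : ℝ → ℂ} (ha : Function.Periodic a (2 * Real.pi)) (θ : ℝ) :
    D.pushforward a (D.point θ) = a θ := by
  set u := (D.exists_point_eq (D.point θ)).choose with hu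
  have h : D.point u = D.point θ := (D.exists_point_eq (D.point θ)).choose_spec
  have hper : Function.Periodic (fun t => (a t, D.point t)) (2 * Real.pi) := fun t =>
    Prod.ext (ha t) (Subtype.ext (D.periodic_point t))
  obtain ⟨y, hy, hy'⟩ := hper.exists_mem_Ico Real.two_pi_pos u (θ - Real.pi)
  have h1 : a u = a y := congrArg Prod.fst hy'
  have h2 : D.point u = D.point y := congrArg Prod.snd hy'
  have h3 : y = θ := by
    by_contra hne
    refine D.loop.p_sub_ne_zero hne ?_ ?_
    · rw [abs_le]
      have := Real.pi_pos
      constructor <;> linarith [hy.1, hy.2]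
    · exact sub_eq_zero.mpr (congrArg Subtype.val (h2.symm.trans h))
  rw [pushforward, ← hu, h1, h3]

theorem pushforward_mem_holderSpace {a : ℝ → ℂ} {C : ℝ} {σ : ℝ≥0}
    (ha : ChordArcLoop.IsHolder a C σ) : D.pushforward a ∈ D.holderSpace σ := by
  have hc := D.loop.c_pos
  have hC := ha.nonneg
  refine ⟨(C / D.loop.c ^ (σ : ℝ)).toNNReal, fun x y => ?_⟩
  obtain ⟨s, rfl⟩ := D.exists_point_eq x
  obtain ⟨t, rfl, hst⟩ := D.exists_point_eq_near y s
  rw [D.pushforward_point ha.periodic, D.pushforward_point ha.periodic, edist_dist, edist_dist,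
    ENNReal.ofReal_rpow_of_nonneg dist_nonneg σ.coe_nonneg, ← ENNReal.ofReal_coe_nnreal,
    ← ENNReal.ofReal_mul NNReal.zero_le_coe, Real.coe_toNNReal _ (by positivity)]
  refine ENNReal.ofReal_le_ofReal ?_
  rw [dist_eq_norm, Subtype.dist_eq, dist_eq_norm]
  refine (ha.bound s t).trans ?_
  rw [div_mul_eq_mul_div, mul_div_assoc, ← Real.div_rpow (norm_nonneg _) hc.le]
  gcongr
  rw [le_div_iff₀ hc, mul_comm]
  exact D.loop.chord s t (by linarith [Real.pi_pos])

end AnalyticJordanDomain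
end

/-! ### A collar of the boundary curve and winding numbers -/

noncomputable section

/-- The radii of a one-sided collar of the unit circle: outside of it for `true`, inside for
`false`. -/
def side (s : Bool) (δ : ℝ) : Set ℝ := if s then Ioo 1 (1 + δ) else Ioo (1 - δ) 1

theorem abs_sub_one_lt_of_mem_side {s : Bool} {δ r : ℝ} (h : r ∈ side s δ) : |r - 1| < δ := by
  rw [abs_lt]
  cases s <;> simp only [side, Bool.false_eq_true, if_true, if_false, mem_Ioo] at h <;>
    constructor <;> linarith [h.1, h.2]

theorem ne_one_of_mem_side {s : Bool} {δ r : ℝ} (h : r ∈ side s δ) : r ≠ 1 := by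
  rintro rfl
  cases s <;> simp [side] at h

theorem side_mono (s : Bool) {δ δ' : ℝ} (h : δ ≤ δ') : side s δ ⊆ side s δ' := by
  cases s <;> intro r hr <;> simp only [side, Bool.false_eq_true, if_true, if_false, mem_Ioo] at * <;>
    constructor <;> linarith [hr.1, hr.2]

theorem mem_side_or {δ r : ℝ} (h : |r - 1| < δ) (s : Bool) :
    r ∈ side s δ ∨ r = 1 ∨ r ∈ side (!s) δ := by
  rw [abs_lt] at h
  rcases lt_trichotomy r 1 with h1 | h1 | h1
  · have : r ∈ side false δ := ⟨by linarith, h1⟩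
    cases s <;> simp [this]
  · exact Or.inr (Or.inl h1)
  · have : r ∈ side true δ := ⟨h1, by linarith⟩
    cases s <;> simp [this]

theorem nonempty_side (s : Bool) {δ : ℝ} (hδ : 0 < δ) : (side s δ).Nonempty := by
  cases s
  · exact nonempty_Ioo.mpr (by linarith)
  · exact nonempty_Ioo.mpr (by linarith)

theorem isOpen_side (s : Bool) (δ : ℝ) : IsOpen (side s δ) := by
  cases s <;> exact isOpen_Ioo

theorem isPreconnected_norm_preimage_side (s : Bool) {δ : ℝ} (hδ : δ < 1) :
    IsPreconnected {w : ℂ | ‖w‖ ∈ side s δ} := by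
  have hc : Convex ℝ (side s δ) := by
    cases s
    · exact convex_Ioo _ _
    · exact convex_Ioo _ _
  have e : {w : ℂ | ‖w‖ ∈ side s δ} =
      (fun x : ℝ × ℝ => circleMap 0 x.1 x.2) '' (side s δ ×ˢ univ) := by
    ext w
    constructor
    · intro hw
      refine ⟨(‖w‖, w.arg), ⟨hw, mem_univ _⟩, ?_⟩
      simp [circleMap_zero]
    · rintro ⟨⟨r, θ⟩, ⟨hr, -⟩, rfl⟩
      have := (abs_lt.mp (abs_sub_one_lt_of_mem_side hr)).1
      simp only at hr
      rw [mem_ofPred_eq, norm_circleMap_zero, abs_of_pos (by linarith)]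
      exact hr
  rw [e]
  refine (hc.isPreconnected.prod isPreconnected_univ).image _ (Continuous.continuousOn ?_)
  unfold circleMap
  fun_prop

namespace AnalyticJordanDomain

variable (D : AnalyticJordanDomain)

/-- `2πi` times the winding number of the boundary curve around `z`. -/
def winding (z : ℂ) : ℂ := ∫ s in (0 : ℝ)..(2 * Real.pi), D.loop.v s / (D.loop.p s - z)

theorem circleIntegral_eq_loop (g : ℂ → ℂ) :
    (∮ w in C(0, 1), g w * deriv D.param w) =
      ∫ s in (0 : ℝ)..(2 * Real.pi), g (circleMap 0 1 s) * D.loop.v s := by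
  unfold circleIntegral
  refine intervalIntegral.integral_congr fun s _ => ?_
  simp only [deriv_circleMap, smul_eq_mul, loop, velocity]
  ring

theorem winding_of_mem {z : ℂ} (hz : z ∈ D.carrier) :
    D.winding z = 2 * Real.pi * Complex.I := by
  have h := D.winding_eq_one z hz
  have e : (∮ w in C(0, 1), deriv D.param w / (D.param w - z)) = D.winding z := by
    have := D.circleIntegral_eq_loop fun w => (D.param w - z)⁻¹
    simp only [inv_mul_eq_div] at this
    exact this
  rw [e] at h
  rw [← mul_one (2 * (Real.pi : ℂ) * Complex.I), ← h,
    mul_inv_cancel_left₀ Complex.two_pi_I_ne_zero]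

theorem loop_ne {z : ℂ} (hz : z ∉ D.curve) (s : ℝ) : D.loop.p s ≠ z := by
  rintro rfl
  exact hz (D.point s).2

theorem hasDerivAt_winding {z : ℂ} (hz : z ∉ D.curve) : HasDerivAt D.winding 0 z := by
  have h0 := fun s => sub_ne_zero.mpr (D.loop_ne hz s)
  have h := hasDerivAt_cauchyType D.loop.continuous_v D.loop.continuous_p (a := 0)
    (b := 2 * Real.pi) (D.loop_ne hz)
  refine h.congr_deriv ?_
  have h1 : ∀ s, HasDerivAt (fun s => -(D.loop.p s - z)⁻¹)
      (D.loop.v s / (D.loop.p s - z) ^ 2) s := by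
    intro s
    have := (((D.loop.hasDerivAt s).sub_const z).inv (h0 s)).neg
    rw [neg_div, neg_neg] at this
    exact this
  rw [intervalIntegral.integral_eq_sub_of_hasDerivAt (fun s _ => h1 s)
    ((D.loop.continuous_v.div ((D.loop.continuous_p.sub continuous_const).pow 2)
      fun s => pow_ne_zero 2 (h0 s)).intervalIntegrable _ _)]
  have := D.loop.periodic_p 0
  rw [zero_add] at this
  rw [this, sub_self]

theorem isCompact_curve : IsCompact D.curve := by
  obtain ⟨U, hU, hS, hd, -⟩ := D.univalent
  exact (isCompact_sphere 0 1).image_of_continuousOn (hd.continuousOn.mono hS)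

theorem frontier_eq_curve : frontier D.carrier = D.curve := D.frontier_eq

theorem closure_eq : closure D.carrier = D.carrier ∪ D.curve := by
  rw [← D.frontier_eq_curve, D.isOpen.frontier_eq, union_sdiff_self,
    union_eq_self_of_subset_left subset_closure]

theorem loop_mem_closure (s : ℝ) : D.loop.p s ∈ closure D.carrier := by
  rw [D.closure_eq]
  exact Or.inr (D.point s).2

theorem not_mem_curve {z : ℂ} (hz : z ∈ D.carrier) : z ∉ D.curve := by
  rw [← D.frontier_eq_curve, D.isOpen.frontier_eq]
  exact fun h => h.2 hz

/-- A consequence of the decay of the winding number at infinity. -/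
theorem isBounded_winding_eq {c : ℂ} (hc : c ≠ 0) : Bornology.IsBounded {z | D.winding z = c} := by
  obtain ⟨R, hR⟩ := isBounded_iff_forall_norm_le.mp D.isCompact_curve.isBounded
  have hV := D.loop.V_nonneg
  have hc0 : 0 < ‖c‖ := norm_pos_iff.mpr hc
  refine isBounded_iff_forall_norm_le.mpr ⟨R + 2 * Real.pi * D.loop.V / ‖c‖, fun z hz => ?_⟩
  by_contra! h
  set m := ‖z‖ - R with hm
  have hm0 : 2 * Real.pi * D.loop.V / ‖c‖ < m := by linarith
  have hmp : 0 < m := lt_of_le_of_lt (by positivity) hm0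
  have h1 := intervalIntegral.norm_integral_le_of_norm_le_const (a := 0) (b := 2 * Real.pi)
    (f := fun s => D.loop.v s / (D.loop.p s - z)) (C := D.loop.V / m) fun s _ => by
      have e1 : ‖D.loop.p s‖ ≤ R := hR _ (D.point s).2
      have e2 := norm_sub_norm_le z (D.loop.p s)
      rw [norm_sub_rev] at e2
      rw [norm_div]
      exact div_le_div₀ hV (D.loop.speed_le s) hmp (by linarith)
  rw [sub_zero, abs_of_pos Real.two_pi_pos] at h1
  have h2 : ‖c‖ ≤ D.loop.V / m * (2 * Real.pi) := by
    rw [← hz]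
    exact h1
  rw [div_mul_eq_mul_div, le_div_iff₀ hmp] at h2
  rw [div_lt_iff₀ hc0] at hm0
  linarith

/-- A bounded set that contains the domain cannot be clopen, as the plane is connected. -/
theorem not_isClopen {W : Set ℂ} (hW : Bornology.IsBounded W) (hsub : D.carrier ⊆ W) :
    ¬ IsClopen W := by
  intro h
  have := h.eq_univ (D.isConnected.nonempty.mono hsub)
  rw [this] at hW
  exact NormedSpace.unbounded_univ ℂ ℂ hW

/-- A two-sided collar of the boundary curve, the image of an annulus on which the parametrization
is univalent, of which one half lies in the domain and the other half has no point in common with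
the closed domain and is not enclosed by the curve. The domain may be on either side of the
unit circle as far as this structure goes, so the side is recorded. -/
structure Collar where
  /-- the side of the unit circle on which the domain is -/
  s : Bool
  /-- the width of the collar -/
  δ : ℝ
  δ_pos : 0 < δ
  δ_lt_one : δ < 1
  differentiableOn : DifferentiableOn ℂ D.param {w | |‖w‖ - 1| < δ}
  injOn : InjOn D.param {w | |‖w‖ - 1| < δ}
  inside : ∀ w, ‖w‖ ∈ side s δ → D.param w ∈ D.carrier
  outside : ∀ w, ‖w‖ ∈ side (!s) δ → D.param w ∉ closure D.carrier
  winding_outside : ∀ w, ‖w‖ ∈ side (!s) δ → D.winding (D.param w) = 0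

theorem isOpen_band (δ : ℝ) : IsOpen {w : ℂ | |‖w‖ - 1| < δ} :=
  isOpen_lt (by fun_prop) continuous_const

theorem nonempty_collar : Nonempty D.Collar := by
  obtain ⟨U, hU, hS, hdU, hiU⟩ := D.univalent
  obtain ⟨ε, hε, hεU⟩ := (isCompact_sphere (0 : ℂ) 1).exists_thickening_subset_open hU hS
  set δ := min ε (1 / 2) with hδ
  have hδ0 : 0 < δ := lt_min hε (by norm_num)
  have hδ1 : δ < 1 := (min_le_right _ _).trans_lt (by norm_num)
  set A : Set ℂ := {w | |‖w‖ - 1| < δ} with hA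
  have hAo : IsOpen A := isOpen_band δ
  have hAU : A ⊆ U := by
    intro w hw
    have hw' : |‖w‖ - 1| < δ := hw
    have hw0 : 0 < ‖w‖ := by linarith [(abs_lt.mp hw').1]
    have hw1 : (‖w‖ : ℂ) ≠ 0 := by exact_mod_cast hw0.ne'
    refine hεU (Metric.mem_thickening_iff.mpr ⟨w / ‖w‖, ?_, ?_⟩)
    · rw [mem_sphere_zero_iff_norm, norm_div, Complex.norm_real, norm_norm, div_self hw0.ne']
    · have e : w - w / ‖w‖ = (w / ‖w‖) * ((‖w‖ - 1 : ℝ) : ℂ) := by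
        push_cast
        field_simp
      rw [dist_eq_norm, e, norm_mul, norm_div, Complex.norm_real, norm_norm, div_self hw0.ne',
        one_mul, Complex.norm_real, Real.norm_eq_abs]
      exact hw'.trans_le (min_le_left _ _)
  have hd : DifferentiableOn ℂ D.param A := hdU.mono hAU
  have hi : InjOn D.param A := hiU.mono hAU
  have hopen : ∀ V ⊆ A, IsOpen V → IsOpen (D.param '' V) := by
    intro V hV hVo
    rw [isOpen_iff_mem_nhds]
    rintro _ ⟨w, hw, rfl⟩
    have h1 := hd.analyticAt (hAo.mem_nhds (hV hw))
    have h2 : map D.param (𝓝 w) = 𝓝 (D.param w) :=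
      h1.hasStrictDerivAt.map_nhds_eq (Complex.deriv_ne_zero_of_injOn hAo hd hi (hV hw))
    rw [← h2]
    exact image_mem_map (hVo.mem_nhds hw)
  have hSA : ∀ w, ‖w‖ = 1 → w ∈ A := fun w hw => by
    change |‖w‖ - 1| < δ
    rw [hw, sub_self, abs_zero]
    exact hδ0
  set T : Bool → Set ℂ := fun s => {w | ‖w‖ ∈ side s δ} with hT
  have hTA : ∀ s, T s ⊆ A := fun s w hw => abs_sub_one_lt_of_mem_side hw
  have hTo : ∀ s, IsOpen (T s) := fun s => (isOpen_side s δ).preimage continuous_norm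
  have hTc : ∀ s, IsPreconnected (D.param '' T s) := fun s =>
    (isPreconnected_norm_preimage_side s hδ1).image _ (hd.continuousOn.mono (hTA s))
  have hTΓ : ∀ s, ∀ w ∈ T s, D.param w ∉ D.curve := by
    rintro s w hw ⟨w', hw', h⟩
    rw [mem_sphere_zero_iff_norm] at hw'
    have := hi (hSA w' hw') (hTA s hw) h
    rw [this] at hw'
    exact ne_one_of_mem_side hw hw'
  have hdich : ∀ s, D.param '' T s ⊆ D.carrier ∨ D.param '' T s ⊆ (closure D.carrier)ᶜ := by
    intro s
    refine IsPreconnected.subset_or_subset D.isOpen isClosed_closure.isOpen_compl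
      (disjoint_compl_right.mono_left subset_closure) ?_ (hTc s)
    rintro _ ⟨w, hw, rfl⟩
    by_cases h : D.param w ∈ D.carrier
    · exact Or.inl h
    · refine Or.inr fun h' => ?_
      rw [D.closure_eq] at h'
      exact h'.elim h (hTΓ s w hw)
  have hAT : ∀ s, ∀ w ∈ A, w ∈ T s ∨ ‖w‖ = 1 ∨ w ∈ T (!s) := fun s w hw => mem_side_or hw s
  have hΓA : D.curve ⊆ D.param '' A := by
    rintro _ ⟨w, hw, rfl⟩
    exact ⟨w, hSA w (mem_sphere_zero_iff_norm.mp hw), rfl⟩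
  have hΓ : ∀ w, ‖w‖ = 1 → D.param w ∈ D.curve := fun w hw =>
    ⟨w, mem_sphere_zero_iff_norm.mpr hw, rfl⟩
  have hAopen := hopen A Subset.rfl hAo
  have hcl : D.curve ⊆ closure D.carrier := by
    rw [D.closure_eq]
    exact subset_union_right
  have hbd : Bornology.IsBounded (closure D.carrier) := D.isBounded.closure
  -- A set around the curve that contains the image of the annulus is a neighbourhood of the
  -- points of the curve, so both halves cannot be in the domain, nor both outside.
  have hside : ∃ s, D.param '' T s ⊆ D.carrier ∧ D.param '' T (!s) ⊆ (closure D.carrier)ᶜ := by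
    by_contra hcon
    push Not at hcon
    rcases hdich false with h1 | h1 <;> rcases hdich true with h2 | h2
    · refine D.not_isClopen hbd subset_closure ⟨isClosed_closure, ?_⟩
      have : closure D.carrier = D.carrier ∪ D.param '' A := by
        refine Subset.antisymm ?_ (union_subset subset_closure ?_)
        · rw [D.closure_eq]
          exact union_subset_union_right _ hΓA
        · rintro _ ⟨w, hw, rfl⟩
          rcases hAT false w hw with h | h | h
          · exact subset_closure (h1 ⟨w, h, rfl⟩)
          · exact hcl (hΓ w h)
          · exact subset_closure (h2 ⟨w, h, rfl⟩)
      rw [this]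
      exact D.isOpen.union hAopen
    · exact hcon false h1 h2
    · exact hcon true h2 h1
    · have h1Γ : D.param 1 ∈ D.curve := hΓ 1 norm_one
      obtain ⟨z, ⟨w, hw, rfl⟩, hz⟩ := mem_closure_iff.mp (hcl h1Γ) _ hAopen (hΓA h1Γ)
      rcases hAT false w hw with h | h | h
      · exact h1 ⟨w, h, rfl⟩ (subset_closure hz)
      · exact D.not_mem_curve hz (hΓ w h)
      · exact h2 ⟨w, h, rfl⟩ (subset_closure hz)
  obtain ⟨s, hs1, hs2⟩ := hside
  refine ⟨⟨s, δ, hδ0, hδ1, hd, hi, fun w hw => hs1 ⟨w, hw, rfl⟩, fun w hw => hs2 ⟨w, hw, rfl⟩,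
    fun w₀ hw₀ => ?_⟩⟩
  -- Otherwise the closed domain together with the points of the same winding number is clopen.
  by_contra hc
  set c := D.winding (D.param w₀) with hcdef
  have hconst : ∀ w ∈ T (!s), D.winding (D.param w) = c := by
    intro w hw
    refine (hopen _ (hTA _) (hTo (!s))).is_const_of_deriv_eq_zero (hTc (!s)) ?_ ?_
      ⟨w, hw, rfl⟩ ⟨w₀, hw₀, rfl⟩
    · rintro _ ⟨x, hx, rfl⟩
      exact (D.hasDerivAt_winding (hTΓ _ x hx)).differentiableAt.differentiableWithinAt
    · rintro _ ⟨x, hx, rfl⟩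
      exact (D.hasDerivAt_winding (hTΓ _ x hx)).deriv
  have hEo : IsOpen (closure D.carrier)ᶜ := isClosed_closure.isOpen_compl
  have hEΓ : ∀ z ∈ (closure D.carrier)ᶜ, z ∉ D.curve := fun z hz h => hz (hcl h)
  have hpre : ∀ t : Set ℂ, IsOpen ((closure D.carrier)ᶜ ∩ D.winding ⁻¹' t) := fun t =>
    hEo.isOpen_inter_preimage_of_deriv_eq_zero
      (fun z hz => (D.hasDerivAt_winding (hEΓ z hz)).differentiableAt.differentiableWithinAt)
      (fun z hz => (D.hasDerivAt_winding (hEΓ z hz)).deriv) t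
  set W := closure D.carrier ∪ ((closure D.carrier)ᶜ ∩ D.winding ⁻¹' {c}) with hW
  refine D.not_isClopen (W := W) ?_ (subset_closure.trans subset_union_left) ⟨?_, ?_⟩
  · exact hbd.union ((D.isBounded_winding_eq hc).subset inter_subset_right)
  · rw [← isOpen_compl_iff]
    convert hpre {c}ᶜ using 1
    ext z
    simp only [hW, mem_compl_iff, mem_union, mem_inter_iff, mem_preimage, mem_singleton_iff]
    tauto
  · have : W = D.carrier ∪ D.param '' A ∪ ((closure D.carrier)ᶜ ∩ D.winding ⁻¹' {c}) := by
      refine Subset.antisymm (union_subset_union_left _ ?_) (union_subset (union_subset ?_ ?_)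
        subset_union_right)
      · rw [D.closure_eq]
        exact union_subset_union_right _ hΓA
      · exact subset_closure.trans subset_union_left
      · rintro _ ⟨w, hw, rfl⟩
        rcases hAT s w hw with h | h | h
        · exact Or.inl (subset_closure (hs1 ⟨w, h, rfl⟩))
        · exact Or.inl (hcl (hΓ w h))
        · exact Or.inr ⟨hs2 ⟨w, h, rfl⟩, hconst w h⟩
    rw [this]
    exact (D.isOpen.union hAopen).union (hpre {c})

end AnalyticJordanDomain
end

/-! ### Cauchy integrals over parallel curves -/

noncomputable section

/-- Fubini's theorem for a Cauchy type integral over `P` of a Cauchy type integral over a disjoint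
curve `p`, by partial fractions. -/
theorem integral_cauchyType_mul_cauchyType {E P Q p : ℝ → ℂ} (hE : Continuous E)
    (hP : Continuous P) (hQ : Continuous Q) (hp : Continuous p) (hPp : ∀ t s, P t ≠ p s) {z : ℂ}
    (hPz : ∀ t, P t ≠ z) (hpz : ∀ s, p s ≠ z) (a b c d : ℝ) :
    (∫ t in a..b, E t / (P t - z) * ∫ s in c..d, Q s / (p s - P t)) =
      (∫ s in c..d, Q s / (p s - z)) * (∫ t in a..b, E t / (P t - z)) -
        ∫ s in c..d, Q s / (p s - z) * ∫ t in a..b, E t / (P t - p s) := by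
  have nP := fun t => sub_ne_zero.mpr (hPz t)
  have np := fun s => sub_ne_zero.mpr (hpz s)
  have npP : ∀ t s, p s - P t ≠ 0 := fun t s => sub_ne_zero.mpr (hPp t s).symm
  have nPp : ∀ t s, P t - p s ≠ 0 := fun t s => sub_ne_zero.mpr (hPp t s)
  have cN : Continuous fun s => ∫ t in a..b, E t / (P t - p s) := by
    refine continuous_iff_continuousAt.mpr fun s => ?_
    exact (hasDerivAt_cauchyType hE hP (a := a) (b := b)
      (fun t => hPp t s)).continuousAt.comp hp.continuousAt
  have cEz : Continuous fun t => E t / (P t - z) := hE.div (hP.sub continuous_const) nP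
  have cQz : Continuous fun s => Q s / (p s - z) := hQ.div (hp.sub continuous_const) np
  have cEp : ∀ s, Continuous fun t => E t / (P t - p s) := fun s =>
    hE.div (hP.sub continuous_const) fun t => nPp t s
  have e1 : (∫ t in a..b, E t / (P t - z) * ∫ s in c..d, Q s / (p s - P t)) =
      ∫ t in a..b, ∫ s in c..d, E t / (P t - z) * (Q s / (p s - P t)) := by
    refine intervalIntegral.integral_congr fun t _ => ?_
    exact (intervalIntegral.integral_const_mul _ _).symm
  have hcont : Continuous fun x : ℝ × ℝ => E x.1 / (P x.1 - z) * (Q x.2 / (p x.2 - P x.1)) :=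
    (cEz.comp continuous_fst).mul ((hQ.comp continuous_snd).div
      ((hp.comp continuous_snd).sub (hP.comp continuous_fst)) fun x => npP x.1 x.2)
  have hint : MeasureTheory.IntegrableOn (Function.uncurry fun t s =>
      E t / (P t - z) * (Q s / (p s - P t))) (uIoc a b ×ˢ uIoc c d)
      (MeasureTheory.volume.prod MeasureTheory.volume) :=
    (hcont.continuousOn.integrableOn_compact (isCompact_uIcc.prod isCompact_uIcc)).mono_set
      (prod_mono uIoc_subset_uIcc uIoc_subset_uIcc)
  rw [e1, MeasureTheory.intervalIntegral_intervalIntegral_swap hint]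
  have e2 : ∀ s, (∫ t in a..b, E t / (P t - z) * (Q s / (p s - P t))) =
      Q s / (p s - z) * (∫ t in a..b, E t / (P t - z)) -
        Q s / (p s - z) * ∫ t in a..b, E t / (P t - p s) := by
    intro s
    rw [← mul_sub, ← intervalIntegral.integral_sub (cEz.intervalIntegrable _ _)
      ((cEp s).intervalIntegrable _ _), ← intervalIntegral.integral_const_mul]
    refine intervalIntegral.integral_congr fun t _ => ?_
    have h1 := nP t
    have h2 := np s
    have h3 := npP t s
    have h4 := nPp t s
    have h5 : P t - p s = -(p s - P t) := by ring
    simp only [h5]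
    field_simp
    ring
  have c1 : Continuous fun s => Q s / (p s - z) * ∫ t in a..b, E t / (P t - z) :=
    cQz.mul continuous_const
  have c2 : Continuous fun s => Q s / (p s - z) * ∫ t in a..b, E t / (P t - p s) := cQz.mul cN
  simp_rw [e2]
  rw [intervalIntegral.integral_sub (c1.intervalIntegrable _ _) (c2.intervalIntegrable _ _),
    intervalIntegral.integral_mul_const]

/-- Cauchy's theorem for a one-sided annulus at the unit circle. -/
theorem circleIntegral_eq_of_mem_side {g : ℂ → ℂ} {t : Bool} {δ ρ : ℝ} (hδ : δ < 1)
    (hc : ContinuousOn g {w | ‖w‖ ∈ insert 1 (side t δ)})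
    (hd : ∀ w, ‖w‖ ∈ side t δ → DifferentiableAt ℂ g w) (hρ : ρ ∈ side t δ) :
    (∮ w in C(0, ρ), g w) = ∮ w in C(0, 1), g w := by
  cases t
  · have hρ' : ρ ∈ Ioo (1 - δ) 1 := hρ
    refine (Complex.circleIntegral_eq_of_differentiable_on_annulus_off_countable
      (s := ∅) (by linarith [hρ'.1]) hρ'.2.le countable_empty (hc.mono ?_) ?_).symm
    · rintro w ⟨h1, h2⟩
      rw [mem_closedBall_zero_iff] at h1
      rw [mem_ball_zero_iff, not_lt] at h2
      rcases h1.eq_or_lt with h | h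
      · exact Or.inl h
      · exact Or.inr ⟨by linarith [hρ'.1], h⟩
    · rintro w ⟨⟨h1, h2⟩, -⟩
      rw [mem_closedBall_zero_iff, not_le] at h2
      rw [mem_ball_zero_iff] at h1
      exact hd w ⟨by linarith [hρ'.1], h1⟩
  · have hρ' : ρ ∈ Ioo 1 (1 + δ) := hρ
    refine Complex.circleIntegral_eq_of_differentiable_on_annulus_off_countable
      (s := ∅) one_pos hρ'.1.le countable_empty (hc.mono ?_) ?_
    · rintro w ⟨h1, h2⟩
      rw [mem_closedBall_zero_iff] at h1
      rw [mem_ball_zero_iff, not_lt] at h2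
      rcases h2.eq_or_lt with h | h
      · exact Or.inl h.symm
      · exact Or.inr ⟨h, by linarith [hρ'.2]⟩
    · rintro w ⟨⟨h1, h2⟩, -⟩
      rw [mem_closedBall_zero_iff, not_le] at h2
      rw [mem_ball_zero_iff] at h1
      exact hd w ⟨h2, by linarith [hρ'.2]⟩

theorem mem_closure_norm_preimage_side (t : Bool) {δ : ℝ} (hδ : 0 < δ) {w : ℂ} (hw : ‖w‖ = 1) :
    w ∈ closure {w : ℂ | ‖w‖ ∈ side t δ} := by
  have h1 : (1 : ℝ) ∈ closure (side t δ) := by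
    cases t
    · simp only [side, Bool.false_eq_true, if_false]
      rw [closure_Ioo (by linarith)]
      exact ⟨by linarith, le_rfl⟩
    · simp only [side, if_true]
      rw [closure_Ioo (by linarith)]
      exact ⟨le_rfl, by linarith⟩
  have h2 : (1 : ℝ) ∈ closure (Ioi 0 ∩ side t δ) :=
    isOpen_Ioi.inter_closure ⟨mem_Ioi.mpr one_pos, h1⟩
  have h3 : Continuous fun r : ℝ => (r : ℂ) * w := by fun_prop
  have h4 := image_closure_subset_closure_image h3 (mem_image_of_mem _ h2)
  simp only [Complex.ofReal_one, one_mul] at h4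
  refine closure_mono ?_ h4
  rintro _ ⟨r, ⟨hr0, hr⟩, rfl⟩
  have hr0' : (0 : ℝ) < r := hr0
  simp only [mem_ofPred_eq, norm_mul, hw, mul_one, Complex.norm_real, Real.norm_eq_abs,
    abs_of_pos hr0']
  exact hr

namespace AnalyticJordanDomain

variable (D : AnalyticJordanDomain)

/-- The Cauchy integral over the boundary curve. -/
def cauchy (q : ℝ → ℂ) (z : ℂ) : ℂ :=
  (2 * Real.pi * Complex.I)⁻¹ *
    ∫ s in (0 : ℝ)..(2 * Real.pi), q s * (D.loop.v s / (D.loop.p s - z))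

/-- The Cauchy integral over the parallel curve `{Φ w : ‖w‖ = ρ}` in the collar; the density is
given as a function of `w`. -/
def parallelCauchy (ρ : ℝ) (h : ℂ → ℂ) (z : ℂ) : ℂ :=
  (2 * Real.pi * Complex.I)⁻¹ *
    ∮ w in C(0, ρ), h w * (deriv D.param w / (D.param w - z))

variable {D}

theorem differentiableAt_cauchy {q : ℝ → ℂ} (hq : Continuous q) {z : ℂ} (hz : z ∉ D.curve) :
    DifferentiableAt ℂ (D.cauchy q) z := by
  have hqv : Continuous fun s => q s * D.loop.v s := hq.mul D.loop.continuous_v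
  have := (hasDerivAt_cauchyType hqv D.loop.continuous_p (a := 0)
    (b := 2 * Real.pi) (D.loop_ne hz)).const_mul (2 * Real.pi * Complex.I)⁻¹
  simp only [mul_div_assoc] at this
  exact this.differentiableAt

theorem parallelCauchy_eq_integral (ρ : ℝ) (h : ℂ → ℂ) (z : ℂ) :
    D.parallelCauchy ρ h z = (2 * Real.pi * Complex.I)⁻¹ * ∫ t in (0 : ℝ)..(2 * Real.pi),
      (circleMap 0 ρ t * Complex.I * h (circleMap 0 ρ t) * deriv D.param (circleMap 0 ρ t)) /
        (D.param (circleMap 0 ρ t) - z) := by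
  unfold parallelCauchy circleIntegral
  congr 1
  refine intervalIntegral.integral_congr fun t _ => ?_
  simp only [deriv_circleMap, smul_eq_mul]
  ring

theorem parallelCauchy_one_eq_cauchy (h : ℂ → ℂ) (z : ℂ) :
    D.parallelCauchy 1 h z = D.cauchy (fun s => h (circleMap 0 1 s)) z := by
  have := D.circleIntegral_eq_loop fun w => h w * (D.param w - z)⁻¹
  unfold parallelCauchy cauchy
  congr 1
  calc _ = ∮ w in C(0, 1), h w * (D.param w - z)⁻¹ * deriv D.param w := by
        congr 1
        funext w
        ring
    _ = _ := this
    _ = _ := intervalIntegral.integral_congr fun s _ => by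
        simp only [loop, point]
        ring

namespace Collar

variable (K : D.Collar)

/-- The half of the collar on the side `t`. -/
def half (t : Bool) : Set ℂ := {w | ‖w‖ ∈ side t K.δ}

theorem half_subset (t : Bool) : K.half t ⊆ {w | |‖w‖ - 1| < K.δ} := fun _ hw =>
  abs_sub_one_lt_of_mem_side hw

theorem mem_band_of_norm_eq_one {w : ℂ} (hw : ‖w‖ = 1) : w ∈ {w : ℂ | |‖w‖ - 1| < K.δ} := by
  rw [mem_ofPred_eq, hw, sub_self, abs_zero]
  exact K.δ_pos

theorem differentiableAt {w : ℂ} (hw : |‖w‖ - 1| < K.δ) : DifferentiableAt ℂ D.param w :=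
  K.differentiableOn.differentiableAt ((isOpen_band K.δ).mem_nhds hw)

theorem differentiableAt_deriv {w : ℂ} (hw : |‖w‖ - 1| < K.δ) :
    DifferentiableAt ℂ (deriv D.param) w :=
  (K.differentiableOn.deriv (isOpen_band K.δ)).differentiableAt ((isOpen_band K.δ).mem_nhds hw)

theorem param_not_mem_curve {t : Bool} {w : ℂ} (hw : w ∈ K.half t) : D.param w ∉ D.curve := by
  rintro ⟨w', hw', h⟩
  rw [mem_sphere_zero_iff_norm] at hw'
  have := K.injOn (K.mem_band_of_norm_eq_one hw') (K.half_subset t hw) h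
  rw [this] at hw'
  exact ne_one_of_mem_side hw hw'

theorem norm_circleMap {t : Bool} {ρ : ℝ} (hρ : ρ ∈ side t K.δ) (θ : ℝ) :
    ‖circleMap 0 ρ θ‖ = ρ := by
  have := (abs_lt.mp (abs_sub_one_lt_of_mem_side hρ)).1
  rw [norm_circleMap_zero, abs_of_pos (by linarith [K.δ_lt_one])]

theorem circleMap_mem {t : Bool} {ρ : ℝ} (hρ : ρ ∈ side t K.δ) (θ : ℝ) :
    circleMap 0 ρ θ ∈ K.half t := by
  change ‖circleMap 0 ρ θ‖ ∈ side t K.δ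
  rwa [K.norm_circleMap hρ]

theorem continuous_param_circleMap {t : Bool} {ρ : ℝ} (hρ : ρ ∈ side t K.δ) :
    Continuous fun θ => D.param (circleMap 0 ρ θ) :=
  K.differentiableOn.continuousOn.comp_continuous (continuous_circleMap 0 ρ)
    fun θ => K.half_subset t (K.circleMap_mem hρ θ)

theorem continuous_density {t : Bool} {ρ : ℝ} (hρ : ρ ∈ side t K.δ) {h : ℂ → ℂ}
    (hh : ContinuousOn h (K.half t)) :
    Continuous fun θ => circleMap 0 ρ θ * Complex.I * h (circleMap 0 ρ θ) *
      deriv D.param (circleMap 0 ρ θ) := by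
  have hc := continuous_circleMap 0 ρ
  have h1 := hh.comp_continuous hc (K.circleMap_mem hρ)
  have h2 := ((K.differentiableOn.deriv (isOpen_band K.δ)).continuousOn).comp_continuous hc
    fun θ => K.half_subset t (K.circleMap_mem hρ θ)
  exact ((hc.mul continuous_const).mul h1).mul h2

theorem continuousAt_parallelCauchy {t : Bool} {ρ : ℝ} (hρ : ρ ∈ side t K.δ) {h : ℂ → ℂ}
    (hh : ContinuousOn h (K.half t)) {z : ℂ} (hz : ∀ θ, D.param (circleMap 0 ρ θ) ≠ z) :
    ContinuousAt (D.parallelCauchy ρ h) z := by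
  have := (hasDerivAt_cauchyType (K.continuous_density hρ hh) (K.continuous_param_circleMap hρ)
    (a := 0) (b := 2 * Real.pi) hz).continuousAt
  have e : D.parallelCauchy ρ h = _ := funext fun z => parallelCauchy_eq_integral ρ h z
  rw [e]
  exact continuousAt_const.mul this

theorem param_circleMap_ne_loop {t : Bool} {ρ : ℝ} (hρ : ρ ∈ side t K.δ) (θ s : ℝ) :
    D.param (circleMap 0 ρ θ) ≠ D.loop.p s := fun h =>
  K.param_not_mem_curve (K.circleMap_mem hρ θ) (h ▸ (D.point s).2)

/-- If the Cauchy integral over a parallel curve is constant on a set that accumulates at the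
boundary curve, it has the same value on the boundary curve. -/
theorem parallelCauchy_loop {t : Bool} {ρ : ℝ} (hρ : ρ ∈ side t K.δ) {h : ℂ → ℂ}
    (hh : ContinuousOn h (K.half t)) {S : Set ℂ} {c : ℂ} (hS : ∀ z ∈ S, D.parallelCauchy ρ h z = c)
    {s : ℝ} (hs : D.loop.p s ∈ closure S) : D.parallelCauchy ρ h (D.loop.p s) = c := by
  have : (𝓝[S] (D.loop.p s)).NeBot := mem_closure_iff_nhdsWithin_neBot.mp hs
  have h1 : Tendsto (D.parallelCauchy ρ h) (𝓝[S] (D.loop.p s))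
      (𝓝 (D.parallelCauchy ρ h (D.loop.p s))) :=
    (K.continuousAt_parallelCauchy hρ hh
      fun θ => K.param_circleMap_ne_loop hρ θ s).tendsto.mono_left nhdsWithin_le_nhds
  refine tendsto_nhds_unique h1 (tendsto_const_nhds.congr' ?_)
  filter_upwards [self_mem_nhdsWithin] with z hz
  exact (hS z hz).symm

/-- Multiplying the density by a Cauchy integral over the boundary curve. -/
theorem parallelCauchy_mul_cauchy {t : Bool} {ρ : ℝ} (hρ : ρ ∈ side t K.δ) {h : ℂ → ℂ}
    (hh : ContinuousOn h (K.half t)) {q : ℝ → ℂ} (hq : Continuous q) {c : ℂ}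
    (hc : ∀ s, D.parallelCauchy ρ h (D.loop.p s) = c) {z : ℂ} (hz : z ∉ D.curve)
    (hzρ : ∀ θ, D.param (circleMap 0 ρ θ) ≠ z) :
    D.parallelCauchy ρ (fun w => h w * D.cauchy q (D.param w)) z =
      (D.parallelCauchy ρ h z - c) * D.cauchy q z := by
  have hqv : Continuous fun s => q s * D.loop.v s := hq.mul D.loop.continuous_v
  have key := integral_cauchyType_mul_cauchyType (K.continuous_density hρ hh)
    (K.continuous_param_circleMap hρ) hqv D.loop.continuous_p
    (K.param_circleMap_ne_loop hρ) hzρ (D.loop_ne hz) 0 (2 * Real.pi) 0 (2 * Real.pi)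
  set k : ℂ := (2 * Real.pi * Complex.I)⁻¹ with hk
  have hk0 : k ≠ 0 := inv_ne_zero Complex.two_pi_I_ne_zero
  have hc' : ∀ s, (∫ t in (0 : ℝ)..(2 * Real.pi), (circleMap 0 ρ t * Complex.I *
      h (circleMap 0 ρ t) * deriv D.param (circleMap 0 ρ t)) /
        (D.param (circleMap 0 ρ t) - D.loop.p s)) = k⁻¹ * c := by
    intro s
    rw [← hc s, parallelCauchy_eq_integral, ← hk, inv_mul_cancel_left₀ hk0]
  simp only [hc', intervalIntegral.integral_mul_const] at key
  have e1 : D.parallelCauchy ρ (fun w => h w * D.cauchy q (D.param w)) z =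
      k * (k * ∫ t in (0 : ℝ)..(2 * Real.pi), (circleMap 0 ρ t * Complex.I *
        h (circleMap 0 ρ t) * deriv D.param (circleMap 0 ρ t)) /
        (D.param (circleMap 0 ρ t) - z) * ∫ s in (0 : ℝ)..(2 * Real.pi),
          q s * D.loop.v s / (D.loop.p s - D.param (circleMap 0 ρ t))) := by
    rw [parallelCauchy_eq_integral, ← hk]
    congr 1
    rw [← intervalIntegral.integral_const_mul k]
    refine intervalIntegral.integral_congr fun θ _ => ?_
    simp only [cauchy, ← hk, ← mul_div_assoc]
    ring
  rw [e1, key, parallelCauchy_eq_integral, cauchy, ← hk]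
  simp only [← mul_div_assoc]
  have aux : ∀ X Y : ℂ, k * (k * (X * Y - X * (k⁻¹ * c))) = (k * Y - c) * (k * X) := fun X Y => by
    field_simp
  exact aux _ _

end Collar
end AnalyticJordanDomain
end

/-! ### Boundary values of Cauchy integrals and their powers -/

noncomputable section
namespace AnalyticJordanDomain

variable {D : AnalyticJordanDomain}

/-- The extension to the closed region of a function `f` given off the boundary curve, with the
boundary values `a` (a periodic function of the parameter). -/
def glue (a : ℝ → ℂ) (f : ℂ → ℂ) (z : ℂ) : ℂ := by
  classical exact if h : z ∈ D.curve then D.pushforward a ⟨z, h⟩ else f z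

theorem glue_loop {a : ℝ → ℂ} (ha : Function.Periodic a (2 * Real.pi)) (f : ℂ → ℂ) (s : ℝ) :
    D.glue a f (D.loop.p s) = a s := by
  have h : D.loop.p s ∈ D.curve := (D.point s).2
  rw [glue, dif_pos h]
  exact D.pushforward_point ha s

theorem glue_of_not_mem (a : ℝ → ℂ) (f : ℂ → ℂ) {z : ℂ} (hz : z ∉ D.curve) :
    D.glue a f z = f z := by
  rw [glue, dif_neg hz]

theorem continuousOn_glue {a : ℝ → ℂ} {C : ℝ} {σ : ℝ≥0} (hσ : 0 < σ)
    (ha : ChordArcLoop.IsHolder a C σ) {f : ℂ → ℂ} {S : Set ℂ} (hS : ∀ z ∈ S, z ∉ D.curve)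
    (hf : ∀ z ∈ S, ContinuousAt f z)
    (hlim : ∀ s, Tendsto f (𝓝[S] (D.loop.p s)) (𝓝 (a s))) :
    ContinuousOn (D.glue a f) (S ∪ D.curve) := by
  rintro z hz
  by_cases h : z ∈ D.curve
  · obtain ⟨s, rfl⟩ : ∃ s, D.loop.p s = z := by
      rw [D.curve_eq_range] at h
      exact h
    refine continuousWithinAt_union.mpr ⟨?_, ?_⟩
    · rw [ContinuousWithinAt, glue_loop ha.periodic]
      refine (hlim s).congr' ?_
      filter_upwards [self_mem_nhdsWithin] with z hz
      exact (glue_of_not_mem a f (hS z hz)).symm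
    · have hc : ContinuousOn (D.glue a f) D.curve := by
        rw [continuousOn_iff_continuous_domRestrict]
        obtain ⟨C', hC'⟩ := D.pushforward_mem_holderSpace ha
        refine (hC'.continuous hσ).congr fun x => ?_
        rw [domRestrict_apply, glue, dif_pos x.2]
      exact hc _ h
  · have h1 : z ∈ S := hz.resolve_right h
    have h2 : D.glue a f =ᶠ[𝓝 z] f := by
      filter_upwards [D.isCompact_curve.isClosed.isOpen_compl.mem_nhds h] with y hy
      exact glue_of_not_mem a f hy
    exact ((hf z h1).congr h2.symm).continuousWithinAt

theorem tendsto_cauchy {q : ℝ → ℂ} {C σ : ℝ} (hq : ChordArcLoop.IsHolder q C σ) (hσ : 0 < σ)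
    {S : Set ℂ} (hS : ∀ z ∈ S, z ∉ D.curve) {n : ℂ}
    (hn : ∀ z ∈ S, D.winding z = 2 * Real.pi * Complex.I * n) (s : ℝ) :
    Tendsto (D.cauchy q) (𝓝[S] (D.loop.p s))
      (𝓝 (n * q s + (2 * Real.pi * Complex.I)⁻¹ * D.loop.sing q s)) := by
  have := (ChordArcLoop.tendsto_cauchyIntegral hq hσ (fun z hz t => D.loop_ne (hS z hz) t) hn
    s).const_mul (2 * Real.pi * Complex.I)⁻¹
  rwa [mul_add, mul_assoc _ n, inv_mul_cancel_left₀ Complex.two_pi_I_ne_zero] at this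

/-- The boundary values of the Cauchy integral from outside the domain. -/
def outerValue (D : AnalyticJordanDomain) (q : ℝ → ℂ) (s : ℝ) : ℂ :=
  (2 * Real.pi * Complex.I)⁻¹ * D.loop.sing q s

/-- The boundary values of the Cauchy integral from inside the domain. -/
def innerValue (D : AnalyticJordanDomain) (q : ℝ → ℂ) (s : ℝ) : ℂ := q s + D.outerValue q s

theorem tendsto_cauchy_inside {q : ℝ → ℂ} {C σ : ℝ} (hq : ChordArcLoop.IsHolder q C σ)
    (hσ : 0 < σ) (s : ℝ) :
    Tendsto (D.cauchy q) (𝓝[D.carrier] (D.loop.p s)) (𝓝 (D.innerValue q s)) := by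
  have := tendsto_cauchy hq hσ (S := D.carrier) (fun z hz => D.not_mem_curve hz) (n := 1)
    (fun z hz => by rw [mul_one]; exact D.winding_of_mem hz) s
  rwa [one_mul] at this

theorem exists_isHolder_outerValue {q : ℝ → ℂ} {C σ : ℝ} (hq : ChordArcLoop.IsHolder q C σ)
    (hσ : 0 < σ) (hσ1 : σ < 1) : ∃ C', ChordArcLoop.IsHolder (D.outerValue q) C' σ := by
  obtain ⟨C', h⟩ := ChordArcLoop.exists_isHolder_sing (γ := D.loop) hq hσ hσ1
  exact ⟨_, h.const_mul _⟩

theorem exists_isHolder_innerValue {q : ℝ → ℂ} {C σ : ℝ} (hq : ChordArcLoop.IsHolder q C σ)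
    (hσ : 0 < σ) (hσ1 : σ < 1) : ∃ C', ChordArcLoop.IsHolder (D.innerValue q) C' σ := by
  obtain ⟨C', h⟩ := exists_isHolder_outerValue (D := D) hq hσ hσ1
  exact ⟨_, hq.add h⟩

theorem cauchy_one (z : ℂ) :
    D.cauchy (fun _ => 1) z = (2 * Real.pi * Complex.I)⁻¹ * D.winding z := by
  simp only [cauchy, one_mul, winding]

theorem cauchy_one_of_mem {z : ℂ} (hz : z ∈ D.carrier) : D.cauchy (fun _ => 1) z = 1 := by
  rw [cauchy_one, D.winding_of_mem hz, inv_mul_cancel₀ Complex.two_pi_I_ne_zero]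

namespace Collar

variable (K : D.Collar)

/-- The Cauchy integral with density the boundary values of a function holomorphic on one half of
the collar may be moved to the parallel curves in that half. -/
theorem parallelCauchy_eq_cauchy {t : Bool} {δ ρ : ℝ} (hδ : δ ≤ K.δ) (hρ : ρ ∈ side t δ)
    {H : ℂ → ℂ} {b : ℝ → ℂ} {z : ℂ}
    (hH : ContinuousOn H (D.param '' {w | ‖w‖ ∈ insert 1 (side t δ)}))
    (hHd : ∀ w, ‖w‖ ∈ side t δ → DifferentiableAt ℂ H (D.param w))
    (hb : ∀ s, H (D.loop.p s) = b s)
    (hz : ∀ w, ‖w‖ ∈ insert 1 (side t δ) → D.param w ≠ z) :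
    D.parallelCauchy ρ (fun w => H (D.param w)) z = D.cauchy b z := by
  have hsub : {w : ℂ | ‖w‖ ∈ insert 1 (side t δ)} ⊆ {w | |‖w‖ - 1| < K.δ} := by
    rintro w (hw | hw)
    · exact K.mem_band_of_norm_eq_one hw
    · exact K.half_subset t (side_mono t hδ hw)
  have e : b = fun s => H (D.param (circleMap 0 1 s)) := funext fun s => (hb s).symm
  rw [e, ← parallelCauchy_one_eq_cauchy (fun w => H (D.param w))]
  unfold parallelCauchy
  congr 1
  refine circleIntegral_eq_of_mem_side (hδ.trans_lt K.δ_lt_one) ?_ ?_ hρ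
  · have h1 : ContinuousOn D.param {w : ℂ | ‖w‖ ∈ insert 1 (side t δ)} :=
      K.differentiableOn.continuousOn.mono hsub
    refine (hH.comp h1 (mapsTo_image _ _)).mul (ContinuousOn.div
      ((K.differentiableOn.deriv (isOpen_band K.δ)).continuousOn.mono hsub)
      (h1.sub continuousOn_const) fun w hw => sub_ne_zero.mpr (hz w hw))
  · intro w hw
    have h1 : |‖w‖ - 1| < K.δ := hsub (Or.inr hw)
    exact ((hHd w hw).comp w (K.differentiableAt h1)).mul ((K.differentiableAt_deriv h1).div
      ((K.differentiableAt h1).sub_const z) (sub_ne_zero.mpr (hz w (Or.inr hw))))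

/-- A point off the curve is not in a sufficiently thin collar. -/
theorem exists_thin {z : ℂ} (hz : z ∉ D.curve) (t : Bool) :
    ∃ δ, 0 < δ ∧ δ ≤ K.δ ∧ ∀ w, ‖w‖ ∈ insert 1 (side t δ) → D.param w ≠ z := by
  have h1 : ∀ w : ℂ, ‖w‖ = 1 → D.param w ≠ z := by
    rintro w hw rfl
    exact hz ⟨w, mem_sphere_zero_iff_norm.mpr hw, rfl⟩
  by_cases h : ∃ w, |‖w‖ - 1| < K.δ ∧ D.param w = z
  · obtain ⟨w₀, hw₀, rfl⟩ := h
    have hpos : 0 < |‖w₀‖ - 1| := abs_pos.mpr (sub_ne_zero.mpr fun h => h1 w₀ h rfl)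
    refine ⟨|‖w₀‖ - 1|, hpos, hw₀.le, ?_⟩
    rintro w (hw | hw) h
    · exact h1 w hw h
    · have h2 := abs_sub_one_lt_of_mem_side hw
      have := K.injOn (h2.trans hw₀ : |‖w‖ - 1| < K.δ) hw₀ h
      rw [this] at h2
      exact lt_irrefl _ h2
  · refine ⟨K.δ, K.δ_pos, le_rfl, ?_⟩
    rintro w (hw | hw) h2
    · exact h1 w hw h2
    · exact h ⟨w, K.half_subset t hw, h2⟩

theorem image_insert_subset (t : Bool) {δ : ℝ} (hδ : δ ≤ K.δ) :
    D.param '' {w | ‖w‖ ∈ insert 1 (side t δ)} ⊆ D.param '' K.half t ∪ D.curve := by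
  rintro _ ⟨w, hw | hw, rfl⟩
  · exact Or.inr ⟨w, mem_sphere_zero_iff_norm.mpr hw, rfl⟩
  · exact Or.inl ⟨w, side_mono t hδ hw, rfl⟩

theorem loop_mem_closure_image_half (t : Bool) (s : ℝ) :
    D.loop.p s ∈ closure (D.param '' K.half t) := by
  have hn : ‖circleMap 0 1 s‖ = 1 := by rw [norm_circleMap_zero, abs_one]
  have h1 : circleMap 0 1 s ∈ closure (K.half t) :=
    mem_closure_norm_preimage_side t K.δ_pos hn
  have h2 : ContinuousWithinAt D.param (K.half t) (circleMap 0 1 s) :=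
    (K.differentiableAt (K.mem_band_of_norm_eq_one hn)).continuousAt.continuousWithinAt
  exact h2.mem_closure_image h1

theorem image_inside_subset : D.param '' K.half K.s ⊆ D.carrier := by
  rintro _ ⟨w, hw, rfl⟩
  exact K.inside w hw

theorem continuousOn_cauchy_comp_pow {q : ℝ → ℂ} (hq : Continuous q) (t : Bool) (n : ℕ) :
    ContinuousOn (fun w => D.cauchy q (D.param w) ^ n) (K.half t) := fun _ hw =>
  (((differentiableAt_cauchy hq (K.param_not_mem_curve hw)).continuousAt.comp
    (K.differentiableAt (K.half_subset t hw)).continuousAt).pow n).continuousWithinAt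

theorem parallelCauchy_one_eq {t : Bool} {δ ρ : ℝ} (hδ : δ ≤ K.δ) (hρ : ρ ∈ side t δ) {z : ℂ}
    (hz : ∀ w, ‖w‖ ∈ insert 1 (side t δ) → D.param w ≠ z) :
    D.parallelCauchy ρ (fun _ => 1) z = (2 * Real.pi * Complex.I)⁻¹ * D.winding z := by
  rw [← cauchy_one]
  exact K.parallelCauchy_eq_cauchy hδ hρ (H := fun _ => 1) continuousOn_const
    (fun _ _ => differentiableAt_const _) (fun _ => rfl) hz

variable {q : ℝ → ℂ}

/-- Powers of the outer Cauchy integral have vanishing Cauchy integrals in the domain. -/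
theorem parallelCauchy_pow_outer (hq : Continuous q) {ρ : ℝ} (hρ : ρ ∈ side (!K.s) K.δ) (n : ℕ)
    {z : ℂ} (hz : z ∈ D.carrier) :
    D.parallelCauchy ρ (fun w => D.cauchy q (D.param w) ^ (n + 1)) z = 0 := by
  have hne : ∀ z ∈ D.carrier, ∀ w, ‖w‖ ∈ insert 1 (side (!K.s) K.δ) → D.param w ≠ z := by
    rintro z hz w (hw | hw) rfl
    · exact D.not_mem_curve hz ⟨w, mem_sphere_zero_iff_norm.mpr hw, rfl⟩
    · exact K.outside w hw (subset_closure hz)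
  have hcont := K.continuousOn_cauchy_comp_pow hq (!K.s)
  have step : ∀ h : ℂ → ℂ, ContinuousOn h (K.half (!K.s)) → ∀ c,
      (∀ z ∈ D.carrier, D.parallelCauchy ρ h z = c) → ∀ z ∈ D.carrier,
      D.parallelCauchy ρ (fun w => h w * D.cauchy q (D.param w)) z = 0 := by
    intro h hh c hc z hz
    rw [K.parallelCauchy_mul_cauchy hρ hh hq (fun s => K.parallelCauchy_loop hρ hh hc (D.loop_mem_closure s))
      (D.not_mem_curve hz) (fun θ => hne z hz _ (Or.inr (K.circleMap_mem hρ θ))), hc z hz,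
      sub_self, zero_mul]
  induction n generalizing z with
  | zero =>
    have := step (fun _ => 1) continuousOn_const 1 (fun z hz => by
      rw [K.parallelCauchy_one_eq le_rfl hρ (hne z hz), ← cauchy_one, cauchy_one_of_mem hz]) z hz
    simpa using this
  | succ n ih =>
    simp only [pow_succ _ (n + 1)]
    exact step _ (hcont _) 0 (fun z hz => ih hz) z hz

/-- The Cauchy integrals over the inner parallel curves of powers of the inner Cauchy integral
vanish outside of the domain. -/
theorem parallelCauchy_pow_inner_outside (hq : Continuous q) {ρ : ℝ} (hρ : ρ ∈ side K.s K.δ)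
    (n : ℕ) {z : ℂ} (hz : z ∈ D.param '' K.half (!K.s)) :
    D.parallelCauchy ρ (fun w => D.cauchy q (D.param w) ^ n) z = 0 := by
  have hΓ : ∀ z ∈ D.param '' K.half (!K.s), z ∉ D.curve := by
    rintro _ ⟨w, hw, rfl⟩
    exact K.param_not_mem_curve hw
  have hne : ∀ z ∈ D.param '' K.half (!K.s), ∀ w, ‖w‖ ∈ insert 1 (side K.s K.δ) →
      D.param w ≠ z := by
    rintro z hz w (hw | hw) rfl
    · exact hΓ _ hz ⟨w, mem_sphere_zero_iff_norm.mpr hw, rfl⟩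
    · obtain ⟨w', hw', h⟩ := hz
      exact K.outside w' hw' (h ▸ subset_closure (K.inside w hw))
  have hcont := K.continuousOn_cauchy_comp_pow hq K.s
  induction n generalizing z with
  | zero =>
    obtain ⟨w, hw, rfl⟩ := hz
    simp only [pow_zero]
    rw [K.parallelCauchy_one_eq le_rfl hρ (hne _ ⟨w, hw, rfl⟩), K.winding_outside w hw, mul_zero]
  | succ n ih =>
    simp only [pow_succ]
    rw [K.parallelCauchy_mul_cauchy hρ (hcont n) hq (fun s => K.parallelCauchy_loop hρ
      (hcont n) (fun z hz => ih hz) (K.loop_mem_closure_image_half _ s)) (hΓ z hz)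
      (fun θ => hne z hz _ (Or.inr (K.circleMap_mem hρ θ))), ih hz, sub_zero, zero_mul]

/-- Powers of the inner Cauchy integral are reproduced, at points of the domain off a thin collar, by
the Cauchy integral over a parallel curve in that collar. -/
theorem parallelCauchy_pow_inner (hq : Continuous q) {δ ρ : ℝ} (hδ : δ ≤ K.δ)
    (hρ : ρ ∈ side K.s δ) (n : ℕ) {z : ℂ} (hz : z ∈ D.carrier)
    (hzδ : ∀ w, ‖w‖ ∈ insert 1 (side K.s δ) → D.param w ≠ z) :
    D.parallelCauchy ρ (fun w => D.cauchy q (D.param w) ^ n) z = D.cauchy q z ^ n := by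
  have hρ' := side_mono K.s hδ hρ
  have hcont := K.continuousOn_cauchy_comp_pow hq K.s
  induction n with
  | zero =>
    simp only [pow_zero]
    rw [K.parallelCauchy_one_eq hδ hρ hzδ, ← cauchy_one, cauchy_one_of_mem hz]
  | succ n ih =>
    simp only [pow_succ]
    rw [K.parallelCauchy_mul_cauchy hρ' (hcont n) hq (fun s => K.parallelCauchy_loop hρ'
      (hcont n) (fun z hz => K.parallelCauchy_pow_inner_outside hq hρ' n hz)
      (K.loop_mem_closure_image_half _ s)) (D.not_mem_curve hz) (fun θ => hzδ _ (Or.inr ?_)), ih,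
      sub_zero]
    rw [K.norm_circleMap hρ']
    exact hρ

end Collar

variable {q : ℝ → ℂ} {C : ℝ} {σ : ℝ≥0}

/-- The inner boundary values of Cauchy integrals are reproduced by the Cauchy integral together
with their powers. -/
theorem cauchy_innerValue_pow (hq : ChordArcLoop.IsHolder q C σ) (hσ : 0 < σ) (hσ1 : σ < 1)
    (n : ℕ) {z : ℂ} (hz : z ∈ D.carrier) :
    D.cauchy (fun s => D.innerValue q s ^ n) z = D.cauchy q z ^ n := by
  obtain ⟨K⟩ := D.nonempty_collar
  have hqc := hq.continuous hσ
  obtain ⟨C', ha⟩ := exists_isHolder_innerValue (D := D) hq hσ hσ1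
  obtain ⟨δ, hδ0, hδ, hzδ⟩ := K.exists_thin (D.not_mem_curve hz) K.s
  obtain ⟨ρ, hρ⟩ := nonempty_side K.s hδ0
  have hc := continuousOn_glue (D := D) (f := D.cauchy q) (S := D.carrier) hσ ha
    (fun z hz => D.not_mem_curve hz)
    (fun z hz => (differentiableAt_cauchy hqc (D.not_mem_curve hz)).continuousAt)
    (fun s => tendsto_cauchy_inside hq hσ s)
  have key := K.parallelCauchy_eq_cauchy (H := fun z => D.glue (D.innerValue q) (D.cauchy q) z ^ n)
    (b := fun s => D.innerValue q s ^ n) (z := z) hδ hρ ((hc.mono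
      ((K.image_insert_subset K.s hδ).trans (union_subset_union_left _ K.image_inside_subset))).pow
      n) ?_ (fun s => by simp only [glue_loop ha.periodic]) hzδ
  · rw [← key, ← K.parallelCauchy_pow_inner hqc hδ hρ n hz hzδ]
    unfold parallelCauchy
    congr 1
    refine circleIntegral.integral_congr ?_ fun w hw => ?_
    · linarith [(abs_lt.mp (abs_sub_one_lt_of_mem_side hρ)).1, K.δ_lt_one]
    · have hw' : ‖w‖ ∈ side K.s K.δ := by
        rw [mem_sphere_zero_iff_norm.mp hw]
        exact side_mono _ hδ hρ
      simp only [glue_of_not_mem _ _ (K.param_not_mem_curve hw')]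
  · intro w hw
    have hw' : D.param w ∉ D.curve := K.param_not_mem_curve (side_mono K.s hδ hw)
    refine ((differentiableAt_cauchy hqc hw').congr_of_eventuallyEq ?_).pow n
    filter_upwards [D.isCompact_curve.isClosed.isOpen_compl.mem_nhds hw'] with y hy
    exact glue_of_not_mem _ _ hy

/-- Positive powers of the outer boundary values have vanishing Cauchy integrals in the domain. -/
theorem cauchy_outerValue_pow (hq : ChordArcLoop.IsHolder q C σ) (hσ : 0 < σ) (hσ1 : σ < 1)
    (n : ℕ) {z : ℂ} (hz : z ∈ D.carrier) :
    D.cauchy (fun s => D.outerValue q s ^ (n + 1)) z = 0 := by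
  obtain ⟨K⟩ := D.nonempty_collar
  have hqc := hq.continuous hσ
  obtain ⟨C', ha⟩ := exists_isHolder_outerValue (D := D) hq hσ hσ1
  obtain ⟨ρ, hρ⟩ := nonempty_side (!K.s) K.δ_pos
  have hΓ : ∀ z ∈ D.param '' K.half (!K.s), z ∉ D.curve := by
    rintro _ ⟨w, hw, rfl⟩
    exact K.param_not_mem_curve hw
  have hc := continuousOn_glue (D := D) (f := D.cauchy q) (S := D.param '' K.half (!K.s)) hσ ha
    hΓ (fun z hz => (differentiableAt_cauchy hqc (hΓ z hz)).continuousAt)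
    (fun s => by
      have := tendsto_cauchy hq hσ hΓ (n := 0) (fun z hz => by
        obtain ⟨w, hw, rfl⟩ := hz
        rw [K.winding_outside w hw, mul_zero]) s
      rwa [zero_mul, zero_add] at this)
  have key := K.parallelCauchy_eq_cauchy (t := !K.s)
    (H := fun z => D.glue (D.outerValue q) (D.cauchy q) z ^ (n + 1))
    (b := fun s => D.outerValue q s ^ (n + 1)) (z := z) le_rfl hρ
    ((hc.mono (K.image_insert_subset _ le_rfl)).pow (n + 1)) ?_
    (fun s => by simp only [glue_loop ha.periodic]) ?_
  · rw [← key, ← K.parallelCauchy_pow_outer hqc hρ n hz]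
    unfold parallelCauchy
    congr 1
    refine circleIntegral.integral_congr ?_ fun w hw => ?_
    · linarith [(abs_lt.mp (abs_sub_one_lt_of_mem_side hρ)).1, K.δ_lt_one]
    · have hw' : ‖w‖ ∈ side (!K.s) K.δ := by
        rw [mem_sphere_zero_iff_norm.mp hw]
        exact hρ
      simp only [glue_of_not_mem _ _ (K.param_not_mem_curve hw')]
  · intro w hw
    have hw' : D.param w ∉ D.curve := K.param_not_mem_curve hw
    refine ((differentiableAt_cauchy hqc hw').congr_of_eventuallyEq ?_).pow (n + 1)
    filter_upwards [D.isCompact_curve.isClosed.isOpen_compl.mem_nhds hw'] with y hy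
    exact glue_of_not_mem _ _ hy
  · rintro w (hw | hw) rfl
    · exact D.not_mem_curve hz ⟨w, mem_sphere_zero_iff_norm.mpr hw, rfl⟩
    · exact K.outside w hw (subset_closure hz)

end AnalyticJordanDomain
end

/-! ### Fixed points of the double layer potential -/

noncomputable section

namespace ChordArcLoop

variable {q r : ℝ → ℂ} {C C' σ : ℝ}

theorem IsHolder.conj (hq : IsHolder q C σ) : IsHolder (fun s => conj (q s)) C σ := by
  refine ⟨fun s => by simp only [hq.periodic s], fun s t => ?_⟩
  rw [← map_sub, RCLike.norm_conj]
  exact hq.bound s t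

theorem IsHolder.exists_norm_le (hq : IsHolder q C σ) (hσ : 0 < σ) : ∃ B, ∀ s, ‖q s‖ ≤ B := by
  obtain ⟨B, hB⟩ := (isCompact_Icc (a := (0 : ℝ)) (b := 2 * Real.pi)).exists_bound_of_continuousOn
    (hq.continuous hσ).continuousOn
  refine ⟨B, fun t => ?_⟩
  obtain ⟨y, hy, h⟩ := hq.periodic.exists_mem_Ico₀ Real.two_pi_pos t
  rw [h]
  exact hB y ⟨hy.1, hy.2.le⟩

theorem IsHolder.exists_mul (hq : IsHolder q C σ) (hr : IsHolder r C' σ) (hσ : 0 < σ) :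
    ∃ C'', IsHolder (fun s => q s * r s) C'' σ := by
  obtain ⟨A, hA⟩ := hq.exists_norm_le hσ
  obtain ⟨B, hB⟩ := hr.exists_norm_le hσ
  have hA0 := (norm_nonneg _).trans (hA 0)
  have hC := hq.nonneg
  refine ⟨A * C' + C * B, fun s => by simp only [hq.periodic s, hr.periodic s], fun s t => ?_⟩
  calc ‖q s * r s - q t * r t‖ = ‖q s * (r s - r t) + (q s - q t) * r t‖ := by
        congr 1
        ring
    _ ≤ A * (C' * |s - t| ^ σ) + C * |s - t| ^ σ * B := by
        refine (norm_add_le _ _).trans ?_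
        rw [norm_mul, norm_mul]
        gcongr
        exacts [hA s, hr.bound s t, hq.bound s t, hB t]
    _ = _ := by ring

theorem IsHolder.exists_pow (hq : IsHolder q C σ) (hσ : 0 < σ) (n : ℕ) :
    ∃ C', IsHolder (fun s => q s ^ n) C' σ := by
  induction n with
  | zero => exact ⟨0, fun _ => by simp, fun _ _ => by simp⟩
  | succ n ih =>
    obtain ⟨C', h⟩ := ih
    simp only [pow_succ]
    exact h.exists_mul hq hσ

end ChordArcLoop

/-- The powers of a function with infinitely many values are linearly independent. -/
theorem linearIndependent_pow_succ_of_infinite_range {X : Type*} {g : X → ℂ}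
    (hg : (range g).Infinite) : LinearIndependent ℂ fun (n : ℕ) => g ^ (n + 1) := by
  have h1 : Function.Injective (Polynomial.aeval (R := ℂ) g) := by
    rw [injective_iff_map_eq_zero]
    intro P hP
    refine Polynomial.eq_zero_of_infinite_isRoot P (hg.mono ?_)
    rintro _ ⟨x, rfl⟩
    have := congrFun hP x
    rw [Polynomial.aeval_fn_apply] at this
    simpa using this
  have h2 := (Polynomial.basisMonomials ℂ).linearIndependent.comp _ (add_left_injective 1)
  have h3 := h2.map' (Polynomial.aeval (R := ℂ) g).toLinearMap (LinearMap.ker_eq_bot.mpr h1)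
  have e : (fun n : ℕ => g ^ (n + 1)) = (Polynomial.aeval (R := ℂ) g).toLinearMap ∘
      Polynomial.basisMonomials ℂ ∘ fun n => n + 1 := by
    funext n
    simp [Polynomial.coe_basisMonomials, Polynomial.aeval_monomial]
  rw [e]
  exact h3

namespace AnalyticJordanDomain

variable {D : AnalyticJordanDomain} {q r : ℝ → ℂ} {C : ℝ} {σ : ℝ≥0}

theorem continuous_cauchy_integrand (hq : Continuous q) {z : ℂ} (hz : z ∉ D.curve) :
    Continuous fun s => q s * (D.loop.v s / (D.loop.p s - z)) :=
  hq.mul (D.loop.continuous_v.div (D.loop.continuous_p.sub continuous_const)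
    fun s => sub_ne_zero.mpr (D.loop_ne hz s))

theorem cauchy_add (hq : Continuous q) (hr : Continuous r) {z : ℂ} (hz : z ∉ D.curve) :
    D.cauchy (fun s => q s + r s) z = D.cauchy q z + D.cauchy r z := by
  unfold cauchy
  rw [← mul_add, ← intervalIntegral.integral_add
    ((continuous_cauchy_integrand hq hz).intervalIntegrable _ _)
    ((continuous_cauchy_integrand hr hz).intervalIntegrable _ _)]
  simp only [add_mul]

theorem cauchy_const_mul (c : ℂ) (q : ℝ → ℂ) (z : ℂ) :
    D.cauchy (fun s => c * q s) z = c * D.cauchy q z := by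
  unfold cauchy
  simp only [mul_assoc, intervalIntegral.integral_const_mul]
  ring

/-- The double layer potential is the sum of a Cauchy integral and a conjugate Cauchy integral. -/
theorem doubleLayer_eq {F : D.curve → ℂ} (hF : Continuous fun s => F (D.point s)) {z : ℂ}
    (hz : z ∈ D.carrier) :
    D.doubleLayer F z = D.cauchy (fun s => F (D.point s)) z +
      conj (D.cauchy (fun s => conj (F (D.point s))) z) := by
  have hz' := D.not_mem_curve hz
  have hF' : Continuous fun s => conj (F (D.point s)) := Complex.continuous_conj.comp hF
  have c1 := continuous_cauchy_integrand hF hz'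
  have c2 : Continuous fun s => conj (conj (F (D.point s)) *
      (D.loop.v s / (D.loop.p s - z))) :=
    Complex.continuous_conj.comp (continuous_cauchy_integrand hF' hz')
  unfold doubleLayer cauchy
  rw [map_mul, ← intervalIntegral.intervalIntegral_conj]
  have hk : conj ((2 * Real.pi * Complex.I : ℂ)⁻¹) = -(2 * Real.pi * Complex.I)⁻¹ := by
    rw [map_inv₀, map_mul, map_mul, Complex.conj_I, Complex.conj_ofReal, map_ofNat, mul_neg,
      inv_neg]
  rw [hk, neg_mul, ← sub_eq_add_neg, ← mul_sub, ← intervalIntegral.integral_sub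
    (c1.intervalIntegrable _ _) (c2.intervalIntegrable _ _), ← intervalIntegral.integral_const_mul,
    ← intervalIntegral.integral_const_mul]
  refine intervalIntegral.integral_congr fun s _ => ?_
  have h1 : (D.kernel z s : ℂ) * (‖D.velocity s‖ : ℂ) =
      ((D.loop.v s / (D.loop.p s - z)).im : ℂ) := by
    rw [← Complex.ofReal_mul, D.kernel_mul_speed hz]
    rfl
  simp only [mul_assoc, h1, map_mul, Complex.conj_conj]
  rw [Complex.im_eq_sub_conj, mul_inv, mul_inv]
  ring

/-- A nonconstant Cauchy integral `f` whose inner boundary values are conjugate to outer boundary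
values of a Cauchy integral yields the infinitely many fixed points `2 Re f ^ (n + 1)`. -/
theorem not_finiteDimensional_fixedPoints (hσ : 0 < σ) (hσ1 : σ < 1) {C' : ℝ}
    (hq : ChordArcLoop.IsHolder q C σ) (hr : ChordArcLoop.IsHolder r C' σ)
    (h : ∀ s, conj (D.innerValue q s) = -D.outerValue r s)
    (hne : ∃ z ∈ D.carrier, ∃ w ∈ D.carrier, D.cauchy q z ≠ D.cauchy q w) :
    ¬ FiniteDimensional ℂ (D.fixedPoints σ hσ) := by
  intro hfin
  have hσ' : (0 : ℝ) < σ := hσ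
  set a := D.innerValue q with ha_def
  obtain ⟨A, ha⟩ : ∃ A, ChordArcLoop.IsHolder a A σ := exists_isHolder_innerValue hq hσ hσ1
  set u : ℕ → ℝ → ℂ := fun n s => a s ^ (n + 1) + conj (a s) ^ (n + 1) with hu_def
  have hu1 : ∀ n, ∃ B, ChordArcLoop.IsHolder (fun s => a s ^ (n + 1)) B σ := fun n =>
    ha.exists_pow hσ' _
  have hu2 : ∀ n, ∃ B, ChordArcLoop.IsHolder (fun s => conj (a s) ^ (n + 1)) B σ := fun n =>
    ha.conj.exists_pow hσ' _
  have hu : ∀ n, ∃ B, ChordArcLoop.IsHolder (u n) B σ := fun n => by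
    obtain ⟨_, h1⟩ := hu1 n
    obtain ⟨_, h2⟩ := hu2 n
    exact ⟨_, h1.add h2⟩
  have hcauchy : ∀ n, ∀ z ∈ D.carrier, D.cauchy (u n) z = D.cauchy q z ^ (n + 1) := by
    intro n z hz
    obtain ⟨_, h1⟩ := hu1 n
    obtain ⟨_, h2⟩ := hu2 n
    have e : (fun s => conj (a s) ^ (n + 1)) =
        fun s => (-1) ^ (n + 1) * D.outerValue r s ^ (n + 1) := by
      funext s
      rw [h s, ← neg_one_mul, mul_pow]
    rw [hu_def, cauchy_add (h1.continuous hσ') (h2.continuous hσ') (D.not_mem_curve hz),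
      cauchy_innerValue_pow hq hσ hσ1 _ hz, e, cauchy_const_mul,
      cauchy_outerValue_pow hr hσ hσ1 n hz, mul_zero, add_zero]
  have hpt : ∀ n s, D.pushforward (u n) (D.point s) = u n s := fun n s => by
    obtain ⟨_, h1⟩ := hu n
    exact D.pushforward_point h1.periodic s
  have hmem : ∀ n, D.pushforward (u n) ∈ D.fixedPoints σ hσ := by
    intro n
    obtain ⟨_, h1⟩ := hu n
    refine ⟨D.pushforward_mem_holderSpace h1, fun ζ => ?_⟩
    obtain ⟨s, rfl⟩ := D.exists_point_eq ζ
    have hlim := (tendsto_cauchy_inside (D := D) hq hσ' s).pow (n + 1)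
    have hlim' := hlim.add ((Complex.continuous_conj.tendsto _).comp hlim)
    have hus : u n s = a s ^ (n + 1) + conj (a s ^ (n + 1)) := by
      simp only [hu_def, map_pow]
    rw [hpt, hus]
    refine hlim'.congr' ?_
    filter_upwards [self_mem_nhdsWithin] with z hz
    have hsymm : (fun s => conj (u n s)) = u n := by
      funext s
      simp only [hu_def, map_add, map_pow, Complex.conj_conj]
      ring
    rw [doubleLayer_eq (by simpa only [hpt] using h1.continuous hσ') hz]
    simp only [hpt, hsymm, hcauchy n z hz, Function.comp_apply]
  set Λ : D.fixedPoints σ hσ →ₗ[ℂ] (D.carrier → ℂ) :=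
    { toFun := fun F z => D.cauchy (fun s => F.1 (D.point s)) z
      map_add' := by
        rintro ⟨F, ⟨_, hF⟩, _⟩ ⟨G, ⟨_, hG⟩, _⟩
        funext z
        exact cauchy_add ((hF.continuous hσ).comp D.continuous_point)
          ((hG.continuous hσ).comp D.continuous_point) (D.not_mem_curve z.2)
      map_smul' := by
        rintro c ⟨F, hF⟩
        funext z
        exact cauchy_const_mul c _ _ } with hΛ
  set g : D.carrier → ℂ := fun z => D.cauchy q z with hg
  have hginf : (range g).Infinite := by
    have e : range g = D.cauchy q '' D.carrier := by
      rw [image_eq_range]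
    rw [e]
    refine (D.isConnected.isPreconnected.image _ fun z hz => ?_).infinite_of_nontrivial ?_
    · exact (differentiableAt_cauchy (hq.continuous hσ')
        (D.not_mem_curve hz)).continuousAt.continuousWithinAt
    · obtain ⟨z, hz, w, hw, hzw⟩ := hne
      exact ⟨_, ⟨z, hz, rfl⟩, _, ⟨w, hw, rfl⟩, hzw⟩
  have hli : LinearIndependent ℂ fun n => (⟨D.pushforward (u n), hmem n⟩ : D.fixedPoints σ hσ) := by
    refine LinearIndependent.of_comp Λ ?_
    convert linearIndependent_pow_succ_of_infinite_range hginf using 1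
    funext n z
    change D.cauchy (fun s => D.pushforward (u n) (D.point s)) z = _
    simp only [hpt]
    exact hcauchy n z z.2
  have := hli.finite_of_isNoetherian
  exact not_finite ℕ

/-- A fixed point is recovered from the inner boundary values of the Cauchy integrals of `q` and of
`conj q`, so one of these is nonconstant if the fixed point is. -/
theorem not_finiteDimensional_of_nonconstant (hσ : 0 < σ) (hσ1 : σ < 1)
    (h : ∃ F ∈ D.fixedPoints σ hσ, ∃ x y : D.curve, F x ≠ F y) :
    ¬ FiniteDimensional ℂ (D.fixedPoints σ hσ) := by
  obtain ⟨F, ⟨⟨C₀, hF⟩, hfix⟩, x, y, hxy⟩ := h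
  have hσ' : (0 : ℝ) < σ := hσ
  obtain ⟨C, hq⟩ := D.isHolder_comp_point hF
  set q : ℝ → ℂ := fun s => F (D.point s) with hq_def
  have hqc := hq.conj
  set r : ℝ → ℂ := fun s => conj (q s) with hr_def
  -- the fixed point equation in terms of boundary values of Cauchy integrals
  have hsum : ∀ s, D.innerValue q s + conj (D.innerValue r s) = q s := by
    intro s
    have : (𝓝[D.carrier] (D.loop.p s)).NeBot :=
      mem_closure_iff_nhdsWithin_neBot.mp (D.loop_mem_closure s)
    have h1 := (tendsto_cauchy_inside (D := D) hq hσ' s).add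
      ((Complex.continuous_conj.tendsto _).comp (tendsto_cauchy_inside (D := D) hqc hσ' s))
    refine tendsto_nhds_unique (h1.congr' ?_) (hfix (D.point s))
    filter_upwards [self_mem_nhdsWithin] with z hz
    exact (doubleLayer_eq (hq.continuous hσ') hz).symm
  have hout : ∀ s, conj (D.innerValue r s) = -D.outerValue q s := by
    intro s
    have h1 := hsum s
    have h2 : D.innerValue q s = q s + D.outerValue q s := rfl
    linear_combination h1 - h2
  have hout' : ∀ s, conj (D.innerValue q s) = -D.outerValue r s := by
    intro s
    have h1 := congrArg conj (hsum s)
    rw [map_add, Complex.conj_conj] at h1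
    have h2 : D.innerValue r s = conj (q s) + D.outerValue r s := rfl
    linear_combination h1 - h2
  by_cases hne : ∃ z ∈ D.carrier, ∃ w ∈ D.carrier, D.cauchy q z ≠ D.cauchy q w
  · exact not_finiteDimensional_fixedPoints hσ hσ1 hq hqc hout' hne
  by_cases hne' : ∃ z ∈ D.carrier, ∃ w ∈ D.carrier, D.cauchy r z ≠ D.cauchy r w
  · exact not_finiteDimensional_fixedPoints hσ hσ1 hqc hq hout hne'
  -- both Cauchy integrals are constant, hence so are their boundary values and `F`
  exfalso
  push Not at hne hne'
  obtain ⟨z₀, hz₀⟩ := D.isConnected.nonempty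
  have hconst : ∀ {f : ℝ → ℂ} {A : ℝ}, ChordArcLoop.IsHolder f A σ →
      (∀ z ∈ D.carrier, ∀ w ∈ D.carrier, D.cauchy f z = D.cauchy f w) →
      ∀ s, D.innerValue f s = D.cauchy f z₀ := by
    intro f A hf hc s
    have : (𝓝[D.carrier] (D.loop.p s)).NeBot :=
      mem_closure_iff_nhdsWithin_neBot.mp (D.loop_mem_closure s)
    refine tendsto_nhds_unique (tendsto_cauchy_inside hf hσ' s) (tendsto_const_nhds.congr' ?_)
    filter_upwards [self_mem_nhdsWithin] with z hz
    exact hc z₀ hz₀ z hz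
  have hFc : ∀ x, F x = D.cauchy q z₀ + conj (D.cauchy r z₀) := by
    intro x
    obtain ⟨s, rfl⟩ := D.exists_point_eq x
    rw [← hconst hq hne s, ← hconst hqc hne' s]
    exact (hsum s).symm
  exact hxy ((hFc x).trans (hFc y).symm)

end AnalyticJordanDomain

end

theorem corollary1p22 (D : AnalyticJordanDomain) (σ : ℝ≥0) (hσ : 0 < σ) (hσ1 : σ < 1)
    (h : ∃ F ∈ D.fixedPoints σ hσ, ∃ x y : D.curve, F x ≠ F y) :
    ¬ FiniteDimensional ℂ (D.fixedPoints σ hσ) :=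
  AnalyticJordanDomain.not_finiteDimensional_of_nonconstant hσ hσ1 h
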